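/- Let $V$ be a simple Euclidean Jordan algebra, that is, a nonzero finite-dimensional real commutative (not necessarily associative) algebra with unit $1$ satisfying $(ab)(aa)=a(b(aa))$, which has no ideals other than $0$ and $V$, and which carries a positive definite symmetric bilinear form for which every multiplication operator $\mathbb L(y):x\mapsto yx$ is symmetric. Let $n=\dim V$. Let $r$ be the rank of $V$, i.e. the maximum over $x\in V$ of the degree of the minimal polynomial of $x$. Let $\operatorname{tr}$ be the trace of $V$, i.e. the linear form on $V$ such that the minimal polynomial of every $x$ of degree $r$ is $X^r-\operatorname{tr}(x)X^{r-1}+\cdots$. Let $d=2d'$ be the Peirce constant, i.e. the common dimension of the spaces $V_{ij}=\{x: c_ix=\tfrac12x,\ c_jx=\tfrac12 x\}$, $i\neq j$, where $(c_1,\dots,c_r)$ is a Jordan frame (a system of pairwise orthogonal primitive idempotents with sum $1$); if $r=1$, $d$ may be any nonnegative integer. For $y\in V$ put $\mathbb P(y)=2\mathbb L(y)^2-\mathbb L(y^2)$ and let $y\otimes y$ be the endomorphism $x\mapsto \operatorname{tr}(yx)\,y$. Let $\mathcal F$ be the space of linear operators on $V$ that are symmetric with respect to the scalar product $\operatorname{tr}(xy)$,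 endowed with the scalar product $\operatorname{Tr}(fg)$, where $\operatorname{Tr}$ is the trace of endomorphisms of $V$. All $y\otimes y$ and $\mathbb P(y)$ belong to $\mathcal F$. Let $\mathcal F_1$ and $\mathcal F_2$ be the linear spans of $\{d'\,y\otimes y+\mathbb P(y): y\in V\}$ and of $\{y\otimes y-\mathbb P(y): y\in V\}$ in $\mathcal F$. Then there is a symmetric endomorphism $\Psi$ of $\mathcal F$ such that the following hold. 1. For all $y\in V$, $\Psi(y\otimes y)=\mathbb P(y)$ and $\Psi(\mathbb P(y))=d'\,y\otimes y+(1-d')\,\mathbb P(y)$. 2. $\mathcal F_1$ and $\mathcal F_2$ are orthogonal and $\mathcal F=\mathcal F_1\oplus\mathcal F_2$. 3. $\mathcal F_1=\ker(\Psi-\mathrm{id})$ and $\mathcal F_2=\ker(\Psi+d'\,\mathrm{id})$; the number $1$ is an eigenvalue of $\Psi$, $-d'$ is an eigenvalue of $\Psi$ if $r\ge 2$, and $\Psi$ has no other eigenvalues. (If $r=1$, then $\mathcal F_2=0$.) 4. The dimensions are given by $$\frac{n(n+1)}{2}-\dim\mathcal F_1=\dim\mathcal F_2=\frac{r(r-1)}{2}\cdot\frac{1+d'(2r-3)+d'^2(r-1)(r-2)}{1+d'}.$$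 -/

import Mathlib

namespace EJA

section Basic

variable {V : Type*} [NonAssocCommRing V] [Module ℝ V]

/-- Powers `x ^ k` in a (not necessarily associative) unital algebra. -/
def pow (x : V) : ℕ → V
  | 0 => 1
  | k + 1 => x * pow x k

/-- The degree of `x`: the least `k` such that `1, x, ..., x ^ k` are linearly dependent,
i.e. the degree of the minimal polynomial of `x`. -/
noncomputable def degree (x : V) : ℕ :=
  sInf {k : ℕ | ¬ LinearIndependent ℝ (fun i : Fin (k + 1) => pow x (i : ℕ))}

variable (V) in
/-- The rank of the algebra: the maximal degree of an element. -/
noncomputable def rank : ℕ := sSup (Set.range (degree : V → ℕ))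

variable (V) in
/-- A Jordan algebra is Euclidean if it carries a positive definite symmetric bilinear form
for which all multiplication operators are symmetric. -/
def IsEuclidean : Prop :=
  ∃ B : V →ₗ[ℝ] V →ₗ[ℝ] ℝ,
    (∀ x y, B x y = B y x) ∧ (∀ x, x ≠ 0 → 0 < B x x) ∧ ∀ x y z, B (x * y) z = B y (x * z)

variable (V) in
/-- A (nonzero) algebra is simple if its only ideals are `0` and the whole algebra. -/
def IsSimple : Prop :=
  Nontrivial V ∧
    ∀ I : Submodule ℝ V, (∀ x y : V, y ∈ I → x * y ∈ I) → I = ⊥ ∨ I = ⊤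

/-- `c` is a primitive idempotent: a nonzero idempotent which is not the sum of two nonzero
idempotents. -/
def IsPrimitive (c : V) : Prop :=
  IsIdempotentElem c ∧ c ≠ 0 ∧
    ∀ a b : V, IsIdempotentElem a → IsIdempotentElem b → c = a + b → a = 0 ∨ b = 0

/-- A Jordan frame: a complete system of orthogonal primitive idempotents. -/
def IsJordanFrame {m : ℕ} (c : Fin m → V) : Prop :=
  (∀ i, IsPrimitive (c i)) ∧ (∀ i j, i ≠ j → c i * c j = 0) ∧ ∑ i, c i = 1

/-- The defining property of the trace: `t` is linear, and for every regular element `x`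
(an element whose degree is the rank `r`) the minimal polynomial of `x` has the form
`X ^ r - t x • X ^ (r - 1) + (terms of degree < r - 1)`. -/
def IsTrace (t : V →ₗ[ℝ] ℝ) : Prop :=
  ∀ x : V, degree x = rank V →
    pow x (rank V) - t x • pow x (rank V - 1) ∈
      Submodule.span ℝ {z : V | ∃ k : ℕ, k + 1 < rank V ∧ z = pow x k}

open Classical in
variable (V) in
/-- The trace of the Jordan algebra `V`: the linear form which on regular elements is the
opposite of the second coefficient of the minimal polynomial (regular elements are dense, so
there is only one such linear form). -/
noncomputable def tr : V →ₗ[ℝ] ℝ :=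
  if h : ∃ t : V →ₗ[ℝ] ℝ, IsTrace t then h.choose else 0

end Basic

section Operators

variable {V : Type*} [NonAssocCommRing V] [Module ℝ V] [SMulCommClass ℝ V V]

/-- The multiplication operator `L(y) : x ↦ y x`. -/
noncomputable def L (y : V) : Module.End ℝ V where
  toFun x := y * x
  map_add' := mul_add y
  map_smul' a x := mul_smul_comm a y x

/-- The quadratic map `P(y) = 2 L(y)² - L(y²)`. -/
noncomputable def P (y : V) : Module.End ℝ V :=
  (2 : ℝ) • (L y * L y) - L (y * y)

/-- The endomorphism `a ⊗ b : x ↦ tr(b x) a`. -/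
noncomputable def tensor (a b : V) : Module.End ℝ V :=
  (tr V ∘ₗ L b).smulRight a

/-- For a frame `c` and `i ≠ j`, the Peirce space `V_ij = V(c_i, 1/2) ∩ V(c_j, 1/2)`. -/
noncomputable def peirceSpace {m : ℕ} (c : Fin m → V) (i j : Fin m) : Submodule ℝ V :=
  Module.End.eigenspace (L (c i)) (1 / 2 : ℝ) ⊓ Module.End.eigenspace (L (c j)) (1 / 2 : ℝ)

variable (V) in
/-- `d` is the Peirce constant of `V`, the dimension of an off-diagonal Peirce space `V_ij`
of a Jordan frame. It is enough to ask this for one frame and one pair `i ≠ j`. In rank one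
there is no such pair, and no condition is put on `d`. -/
def IsPeirceConstant (d : ℕ) : Prop :=
  rank V ≠ 1 → ∃ c : Fin (rank V) → V, IsJordanFrame c ∧
    ∃ i j, i ≠ j ∧ Module.finrank ℝ (peirceSpace c i j) = d

end Operators

section Spaces

variable (V : Type*) [NonAssocCommRing V] [Module ℝ V] [SMulCommClass ℝ V V]
  [IsScalarTower ℝ V V]

/-- The space `F` of linear operators on `V` that are symmetric for the scalar product
`tr(x y)`. -/
noncomputable def symOp : Submodule ℝ (Module.End ℝ V) where
  carrier := {f | ∀ x y : V, tr V (f x * y) = tr V (x * f y)}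
  add_mem' {f g} hf hg x y := by
    simp only [LinearMap.add_apply, add_mul, mul_add, map_add, hf x y, hg x y]
  zero_mem' x y := by simp
  smul_mem' a f hf x y := by
    simp only [LinearMap.smul_apply, smul_mul_assoc, mul_smul_comm, map_smul, hf x y]

variable {V} in
theorem tensor_self_mem (y : V) : tensor y y ∈ symOp V := by
  intro x z
  change tr V ((tr V (y * x) • y) * z) = tr V (x * (tr V (y * z) • y))
  rw [smul_mul_assoc, mul_smul_comm, map_smul, map_smul, smul_eq_mul, smul_eq_mul,
    mul_comm x y, mul_comm]

/-- The span `F₁` in `F` of the operators `d' y ⊗ y + P(y)`. -/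
noncomputable def F₁ (d' : ℝ) : Submodule ℝ (symOp V) :=
  Submodule.span ℝ {f | ∃ y : V, (f : Module.End ℝ V) = d' • tensor y y + P y}

/-- The span `F₂` in `F` of the operators `y ⊗ y - P(y)`. -/
noncomputable def F₂ : Submodule ℝ (symOp V) :=
  Submodule.span ℝ {f | ∃ y : V, (f : Module.End ℝ V) = tensor y y - P y}

end Spaces

end EJA

/-! Let `B x y = tr (x y)` and let `P(x, y) = L x L y + L y L x - L (x y)` be the polarized
quadratic map. The operator `Ψ` is the restriction to `F` of the linear map on `End V` with `x ⊗ y ↦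
P(x, y)`, that is `f ↦ ∑ P(f b_k, b_k)` for an orthonormal basis (`casimir`, `casimir_tensor`). It
is symmetric because `B (P(a, b) x) y` does not change when `(a, b)` and `(x, y)` are exchanged
(`polarP_comm`).

The heart is the formula for `Ψ (P y)`. Write `y = ∑ a_i c_i` in a Jordan frame; then `P y = ∑ a_i
a_j P(c_i, c_j)`. For `i ≠ j` the operator `2 P(c_i, c_j)` is the orthogonal projection onto `V_ij`,
hence the sum of `e ⊗ e` over an orthonormal basis of `V_ij`, and `Ψ` sends it to the sum of the `P
e`. Each `P e` is known explicitly (`P_of_mem`), and adding the `2d'` of them gives `casimir_proj`,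
hence `casimir_P`.

Since the `y ⊗ y` span `F`, the two formulas make `Ψ` diagonalizable with eigenvalues among `1` and
`-d'`. The dimensions solve two linear equations: `dim F₁ + dim F₂ = n(n+1)/2` and `dim F₁ - d' dim
F₂ = Tr Ψ`. The trace equals `B (∑ b_k²) (∑ b_l²) = τ² r`, where `Tr L(x) = τ tr x` and `τ = 1 +
(r-1) d'` (`trace_casimir`).

The preparation derives from the Jordan identity the spectral theorem, the Peirce rules, the equal
length of all frames and of their idempotents (`form_eq`, `card_eq_rank`), and hence that `tr (x y)`
is a positive definite invariant form for which frames are orthonormal (`exists_trace_form`). -/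

set_option linter.unusedSectionVars false

namespace EJA

/-! ### Linear algebra for a positive definite form. -/

section LinearAlgebra

variable {V : Type*} [AddCommGroup V] [Module ℝ V] [FiniteDimensional ℝ V]

/-- A positive definite symmetric bilinear form, as an inner product core. -/
noncomputable abbrev innerCore (B : V →ₗ[ℝ] V →ₗ[ℝ] ℝ) (hs : ∀ x y, B x y = B y x)
    (hp : ∀ x, x ≠ 0 → 0 < B x x) : InnerProductSpace.Core ℝ V where
  inner x y := B x y
  conj_inner_symm x y := hs y x
  re_inner_nonneg x := by
    by_cases h : x = 0
    · simp [h]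
    · exact (hp x h).le
  add_left x y z := by simp
  smul_left x y r := by simp
  definite x h := by
    by_contra hx
    exact (hp x hx).ne' h

theorem iSup_eigenspace_eq_top_of_symmetric (B : V →ₗ[ℝ] V →ₗ[ℝ] ℝ)
    (hs : ∀ x y, B x y = B y x) (hp : ∀ x, x ≠ 0 → 0 < B x x) (T : Module.End ℝ V)
    (hT : ∀ x y, B (T x) y = B x (T y)) : ⨆ μ, Module.End.eigenspace T μ = ⊤ := by
  let _ : NormedAddCommGroup V := (innerCore B hs hp).toNormedAddCommGroup
  let _ : InnerProductSpace ℝ V := InnerProductSpace.ofCore (innerCore B hs hp).toCore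
  have h : T.IsSymmetric := hT
  have := h.orthogonalComplement_iSup_eigenspaces_eq_bot
  exact (Submodule.orthogonal_eq_bot_iff).1 this

theorem exists_orthonormal_family (B : V →ₗ[ℝ] V →ₗ[ℝ] ℝ)
    (hs : ∀ x y, B x y = B y x) (hp : ∀ x, x ≠ 0 → 0 < B x x) (W : Submodule ℝ V) :
    ∃ b : Fin (Module.finrank ℝ W) → V, (∀ i, b i ∈ W) ∧
      (∀ i j, B (b i) (b j) = if i = j then 1 else 0) ∧
      ∀ x ∈ W, x = ∑ i, B (b i) x • b i := by
  let _ : NormedAddCommGroup V := (innerCore B hs hp).toNormedAddCommGroup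
  let _ : InnerProductSpace ℝ V := InnerProductSpace.ofCore (innerCore B hs hp).toCore
  let o := stdOrthonormalBasis ℝ W
  refine ⟨fun i => (o i : V), fun i => (o i).2, fun i j => ?_, fun x hx => ?_⟩
  · exact (orthonormal_iff_ite.1 o.orthonormal i j)
  · have := congrArg (Subtype.val) (o.sum_repr' ⟨x, hx⟩)
    rw [AddSubmonoidClass.coe_finsetSum] at this
    exact this.symm

/-- The expansion makes `f` a sum of rank-one maps; independence of `b` is not needed. -/
theorem trace_eq_sum_of_expansion {ι : Type*} [Fintype ι] (φ : ι → V →ₗ[ℝ] ℝ) (b : ι → V)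
    (hb : ∀ x, x = ∑ i, φ i x • b i) (f : Module.End ℝ V) :
    LinearMap.trace ℝ V f = ∑ i, φ i (f (b i)) := by
  have : f = ∑ i, (φ i).smulRight (f (b i)) := by
    ext x
    conv_lhs => rw [hb x]
    simp
  conv_lhs => rw [this]
  simp [LinearMap.trace_smulRight]

end LinearAlgebra

end EJA

namespace EJA

/-! ### The linearized Jordan identity and power associativity. -/

section Identities

variable {V : Type*} [NonAssocCommRing V] [Module ℝ V] [SMulCommClass ℝ V V]
  [IsScalarTower ℝ V V] [IsCommJordan V]

@[simp] theorem L_apply (x y : V) : L x y = x * y := rfl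

theorem L_add (x y : V) : L (x + y) = L x + L y := by
  ext z; simp [add_mul]

theorem L_smul (a : ℝ) (x : V) : L (a • x) = a • L x := by
  ext z; simp [smul_mul_assoc]

/-- The linearized Jordan identity. -/
theorem jordan_linearized (a b c x : V) :
    a * ((b * c) * x) - (b * c) * (a * x) + (b * ((c * a) * x) - (c * a) * (b * x)) +
      (c * ((a * b) * x) - (a * b) * (c * x)) = 0 := by
  have h := DFunLike.congr_fun (two_nsmul_lie_lmul_lmul_add_add_eq_zero a b c) x
  simp only [Ring.lie_def] at h
  have h2 : (2 : ℝ) • (a * ((b * c) * x) - (b * c) * (a * x) +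
      (b * ((c * a) * x) - (c * a) * (b * x)) +
      (c * ((a * b) * x) - (a * b) * (c * x))) = 0 := by
    rw [← ofNat_smul_eq_nsmul ℝ] at h
    exact h
  exact (smul_eq_zero.1 h2).resolve_left two_ne_zero

/-- The linearized Jordan identity, read as an expression for `L ((a * b) * x)`. -/
theorem jordan_mul (a b x y : V) :
    ((a * b) * x) * y = (a * b) * (x * y) + (a * x) * (b * y) + (b * x) * (a * y) -
      a * (x * (b * y)) - b * (x * (a * y)) := by
  have h := jordan_linearized a b y x
  have e1 : b * y * x = x * (b * y) := mul_comm _ _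
  have e2 : y * a * x = x * (a * y) := by rw [mul_comm y a, mul_comm]
  have e3 : b * y * (a * x) = a * x * (b * y) := mul_comm _ _
  have e4 : y * a * (b * x) = b * x * (a * y) := by rw [mul_comm y a, mul_comm]
  have e5 : y * (a * b * x) = a * b * x * y := mul_comm _ _
  have e6 : y * x = x * y := mul_comm _ _
  rw [e1, e2, e3, e4, e5, e6] at h
  linear_combination (norm := module) h

theorem L_jordan_mul (a b x : V) :
    L ((a * b) * x) = L (a * b) * L x + L (a * x) * L b + L (b * x) * L a -
      L a * (L x * L b) - L b * (L x * L a) := by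
  ext y
  exact jordan_mul a b x y

/-- By `L_jordan_mul`, `L (x ^ (n+2))` is a polynomial in `L x`, `L (x²)`, `L (x ^ n)` and `L (x ^
(n+1))`, so strong induction reduces to the Jordan axiom `[L x, L (x²)] = 0`. -/
theorem commute_L_pow (x : V) (n : ℕ) : Commute (L x) (L (pow x n)) := by
  have h0 : Commute (L x) (L (1 : V)) := by
    have : L (1 : V) = 1 := by ext y; simp
    rw [this]; exact Commute.one_right _
  have h1 : Commute (L x) (L x) := Commute.refl _
  have h2 : Commute (L x) (L (x * x)) := by
    ext y
    have := IsJordan.lmul_lmul_comm_lmul x y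
    simpa using this.symm
  induction n using Nat.strong_induction_on with
  | _ n ih =>
    match n with
    | 0 => exact h0
    | 1 => simp [pow]
    | n + 2 =>
      have e : pow x (n + 2) = (x * pow x n) * x := mul_comm _ _
      have i0 := ih n (by omega)
      have i1 : Commute (L x) (L (x * pow x n)) := ih (n + 1) (by omega)
      rw [e, L_jordan_mul, mul_comm (pow x n) x]
      exact ((((i1.mul_right h1).add_right (h2.mul_right i0)).add_right (i1.mul_right h1)).sub_right
        (h1.mul_right (h1.mul_right i0))).sub_right (i0.mul_right (h1.mul_right h1))

theorem pow_eq_L_pow (x : V) (n : ℕ) : pow x n = (L x ^ n) 1 := by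
  induction n with
  | zero => rfl
  | succ n ih => rw [pow_succ', Module.End.mul_apply, ← ih]; rfl

open Polynomial in
theorem commute_L_aeval (x : V) (p : ℝ[X]) : Commute (L x) (L (aeval (L x) p 1)) := by
  induction p using Polynomial.induction_on' with
  | add p q hp hq => simp only [map_add, LinearMap.add_apply, L_add]; exact hp.add_right hq
  | monomial n a =>
    rw [aeval_monomial, Module.End.mul_apply, ← pow_eq_L_pow, Module.algebraMap_end_apply, L_smul]
    exact (commute_L_pow x n).smul_right a

open Polynomial in
-- `L (p(x))` commutes with `q (L x)`; apply both products to `1`. This form of power associativity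
-- is what the spectral theorem needs.
theorem aeval_mul_aeval (x : V) (p q : ℝ[X]) :
    aeval (L x) p 1 * aeval (L x) q 1 = aeval (L x) q (aeval (L x) p 1) := by
  have h : Commute (L (aeval (L x) p 1)) (aeval (L x) q) :=
    Algebra.commute_of_mem_adjoin_singleton_of_commute
      (aeval_mem_adjoin_singleton ℝ (L x)) (commute_L_aeval x p).symm
  have := LinearMap.congr_fun h.eq 1
  simpa using this

end Identities

/-! ### Peirce rules for one idempotent. -/

section Peirce

variable {V : Type*} [NonAssocCommRing V] [Module ℝ V] [SMulCommClass ℝ V V]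
  [IsScalarTower ℝ V V] [IsCommJordan V]

/-- The Jordan identity with all entries `c`: `L c` is a root of `t (2t - 1) (t - 1)`. -/
theorem peirce_cubic {c : V} (hc : c * c = c) (x : V) :
    (2 : ℝ) • (c * (c * (c * x))) - (3 : ℝ) • (c * (c * x)) + c * x = 0 := by
  have h := jordan_mul c c c x
  rw [hc, hc] at h
  linear_combination (norm := module) h

/-- Multiplication rule for Peirce spaces, `μ ≠ 1/2`. -/
theorem peirce_mul {c : V} (hc : c * c = c) {x y : V} {a b : ℝ} (hx : c * x = a • x)
    (hy : c * y = b • y) (hb : b ≠ 1 / 2) : c * (x * y) = a • (x * y) := by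
  have h := jordan_mul c c x y
  rw [hc, hx, hy] at h
  simp only [smul_mul_assoc, mul_smul_comm] at h
  have : (1 - 2 * b) • (c * (x * y) - a • (x * y)) = 0 := by
    linear_combination (norm := module) -h
  rcases smul_eq_zero.1 this with h | h
  · exact absurd (by linarith) hb
  · exact sub_eq_zero.1 h

/-- Multiplying by `y` preserves the eigenvalue of `x`, and multiplying by `x` preserves that of
`y`; so `x y` has eigenvalue both `1` and `0`. -/
theorem peirce_mul_one_zero {c : V} (hc : c * c = c) {x y : V} (hx : c * x = x)
    (hy : c * y = 0) : x * y = 0 := by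
  have h1 := peirce_mul hc (x := x) (y := y) (a := 1) (b := 0) (by simpa) (by simpa) (by norm_num)
  have h2 := peirce_mul hc (x := y) (y := x) (a := 0) (b := 1) (by simpa) (by simpa) (by norm_num)
  rw [mul_comm y x, h1] at h2
  simpa using h2

theorem peirce_mul_one_one {c : V} (hc : c * c = c) {x y : V} (hx : c * x = x)
    (hy : c * y = y) : c * (x * y) = x * y := by
  have := peirce_mul hc (x := x) (y := y) (a := 1) (b := 1) (by simpa) (by simpa) (by norm_num)
  simpa using this

theorem peirce_mul_half_zero {c : V} (hc : c * c = c) {x y : V} (hx : c * x = (1 / 2 : ℝ) • x)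
    (hy : c * y = 0) : c * (x * y) = (1 / 2 : ℝ) • (x * y) :=
  peirce_mul hc (b := 0) hx (by simpa) (by norm_num)

/-- The product of two elements of the Peirce space `V_{1/2}` lies in `V_1 + V_0`. -/
theorem peirce_mul_half_half {c : V} (hc : c * c = c) {x y : V} (hx : c * x = (1 / 2 : ℝ) • x)
    (hy : c * y = (1 / 2 : ℝ) • y) : c * (c * (x * y)) = c * (x * y) := by
  have h := jordan_linearized c x y c
  rw [mul_comm y c, hx, hy, hc, mul_comm (x * y) c] at h
  simp only [smul_mul_assoc, mul_smul_comm, mul_comm y x, mul_comm y c, mul_comm x c, hx, hy] at h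
  linear_combination (norm := module) h

theorem commute_of_one {c : V} (hc : c * c = c) {x : V} (hx : c * x = x) (y : V) :
    c * (x * y) = x * (c * y) := by
  have h := jordan_linearized c c x y
  rw [mul_comm x c, hx, hc] at h
  linear_combination (norm := module) h

theorem commute_of_zero {c : V} (hc : c * c = c) {x : V} (hx : c * x = 0) (y : V) :
    c * (x * y) = x * (c * y) := by
  have h := jordan_linearized c c x y
  rw [mul_comm x c, hx, hc] at h
  simp only [zero_mul, mul_zero] at h
  linear_combination (norm := module) -h

end Peirce

end EJA

namespace EJA

/-! ### Complete systems of orthogonal idempotents and degrees. -/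

section Systems

variable {V : Type*} [NonAssocCommRing V] [Module ℝ V] [SMulCommClass ℝ V V]
  [IsScalarTower ℝ V V]

/-- A positive definite symmetric bilinear form for which multiplications are symmetric. -/
structure IsInvariantForm (B : V →ₗ[ℝ] V →ₗ[ℝ] ℝ) : Prop where
  symm : ∀ x y, B x y = B y x
  pos : ∀ x, x ≠ 0 → 0 < B x x
  inv : ∀ x y z, B (x * y) z = B y (x * z)

/-- A complete system of nonzero orthogonal idempotents. -/
structure IsSystem {m : ℕ} (c : Fin m → V) : Prop where
  ne_zero : ∀ i, c i ≠ 0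
  idem : ∀ i, c i * c i = c i
  orth : ∀ i j, i ≠ j → c i * c j = 0
  sum_eq : ∑ i, c i = 1

theorem IsJordanFrame.isSystem {m : ℕ} {c : Fin m → V} (hc : IsJordanFrame c) : IsSystem c :=
  ⟨fun i => (hc.1 i).2.1, fun i => (hc.1 i).1, hc.2.1, hc.2.2⟩

namespace IsSystem

variable {m : ℕ} {c : Fin m → V}

theorem mul_eq (hc : IsSystem c) (i j : Fin m) : c i * c j = if i = j then c i else 0 := by
  split_ifs with h
  · rw [h, hc.idem]
  · exact hc.orth i j h

theorem mul_sum (hc : IsSystem c) (j : Fin m) (a : Fin m → ℝ) :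
    c j * ∑ i, a i • c i = a j • c j := by
  simp [Finset.mul_sum, mul_smul_comm, hc.mul_eq]

theorem sum_mul_sum (hc : IsSystem c) (a b : Fin m → ℝ) :
    (∑ i, a i • c i) * ∑ i, b i • c i = ∑ i, (a i * b i) • c i := by
  rw [Finset.sum_mul]
  refine Finset.sum_congr rfl fun i _ => ?_
  rw [smul_mul_assoc, hc.mul_sum, smul_smul]

theorem linearIndependent (hc : IsSystem c) : LinearIndependent ℝ c := by
  rw [Fintype.linearIndependent_iff]
  intro g hg i
  have := hc.mul_sum i g
  rw [hg, mul_zero] at this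
  exact (smul_eq_zero.1 this.symm).resolve_right (hc.ne_zero i)

theorem card_le [FiniteDimensional ℝ V] (hc : IsSystem c) : m ≤ Module.finrank ℝ V := by
  simpa using hc.linearIndependent.fintype_card_le_finrank

theorem pow_sum (hc : IsSystem c) (a : Fin m → ℝ) (k : ℕ) :
    pow (∑ i, a i • c i) k = ∑ i, a i ^ k • c i := by
  induction k with
  | zero => simp [pow, hc.sum_eq]
  | succ k ih => rw [pow, ih, hc.sum_mul_sum]; simp only [_root_.pow_succ']

theorem linearIndependent_pow (hc : IsSystem c) {a : Fin m → ℝ} (ha : Function.Injective a) :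
    LinearIndependent ℝ (fun k : Fin m => pow (∑ i, a i • c i) (k : ℕ)) := by
  rw [Fintype.linearIndependent_iff]
  intro g hg
  have h2 : ∑ i, (∑ k, g k * a i ^ (k : ℕ)) • c i = 0 := by
    rw [← hg]
    simp only [hc.pow_sum, Finset.smul_sum, Finset.sum_smul, smul_smul]
    exact Finset.sum_comm
  have h3 := Fintype.linearIndependent_iff.1 hc.linearIndependent _ h2
  have h4 := Matrix.eq_zero_of_forall_index_sum_mul_pow_eq_zero ha h3
  exact fun i => congrFun h4 i

/-- All powers lie in the `m`-dimensional span of the `c i`, and for distinct coefficients the first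
`m` are independent by Vandermonde. -/
theorem degree_sum (hc : IsSystem c) {a : Fin m → ℝ} (ha : Function.Injective a) :
    degree (∑ i, a i • c i) = m := by
  have hmem : m ∈ {k : ℕ | ¬ LinearIndependent ℝ
      (fun i : Fin (k + 1) => pow (∑ i, a i • c i) (i : ℕ))} := by
    intro hli
    have h1 := finrank_span_eq_card hli
    have h2 : Submodule.span ℝ (Set.range fun i : Fin (m + 1) => pow (∑ i, a i • c i) (i : ℕ)) ≤
        Submodule.span ℝ (Set.range c) := by
      rw [Submodule.span_le]
      rintro _ ⟨k, rfl⟩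
      simp only [hc.pow_sum]
      exact Submodule.sum_mem _ fun i _ =>
        Submodule.smul_mem _ _ (Submodule.subset_span (Set.mem_range_self i))
    have : FiniteDimensional ℝ (Submodule.span ℝ (Set.range c)) :=
      FiniteDimensional.span_of_finite ℝ (Set.finite_range c)
    have h3 := Submodule.finrank_mono h2
    have h4 := finrank_range_le_card (R := ℝ) c
    rw [Set.finrank] at h4
    simp at h1 h4
    omega
  refine le_antisymm (Nat.sInf_le hmem) (le_csInf ⟨m, hmem⟩ fun k hk => ?_)
  by_contra hlt
  push Not at hlt
  refine hk ?_
  have := (hc.linearIndependent_pow ha).comp (Fin.castLE (by omega : k + 1 ≤ m))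
    (Fin.castLE_injective _)
  exact this

end IsSystem

end Systems

/-! ### Spectral theorem, existence of frames, primitive idempotents. -/

section Spectral

variable {V : Type*} [NonAssocCommRing V] [Module ℝ V] [SMulCommClass ℝ V V]
  [IsScalarTower ℝ V V] [IsCommJordan V] [FiniteDimensional ℝ V]
  {B : V →ₗ[ℝ] V →ₗ[ℝ] ℝ}

open Polynomial in
/-- The spectral theorem: `1` is a sum of orthogonal idempotents which are polynomials in `x`. -/
theorem exists_spectral (hB : IsInvariantForm B) (x : V) :
    ∃ (m : ℕ) (v : Fin m → V) (a : Fin m → ℝ), IsSystem v ∧ Function.Injective a ∧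
      (∀ i, x * v i = a i • v i) ∧ ∀ i, ∃ p : ℝ[X], v i = aeval (L x) p 1 := by
  have htop := iSup_eigenspace_eq_top_of_symmetric B hB.symm hB.pos (L x)
    (fun y z => by
      have := hB.inv x y z
      simpa using this)
  have h1 : (1 : V) ∈ ⨆ μ, Module.End.eigenspace (L x) μ := htop ▸ Submodule.mem_top
  obtain ⟨f, hf, hsum⟩ := (Submodule.mem_iSup_iff_exists_finsupp _ _).1 h1
  have hev : ∀ μ, L x (f μ) = μ • f μ := fun μ => Module.End.mem_eigenspace_iff.1 (hf μ)
  have hpol : ∀ (p : ℝ[X]) (μ : ℝ), aeval (L x) p (f μ) = p.eval μ • f μ := fun p μ =>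
    Module.End.aeval_apply_of_mem_apply_eq_smul (hev μ)
  have hsum' : ∑ μ ∈ f.support, f μ = 1 := hsum
  -- The eigencomponents of `1` under `L x` are the spectral idempotents; Lagrange interpolation
  -- exhibits each as a polynomial in `x`, which then makes them multiply orthogonally.
  have hlag : ∀ μ ∈ f.support, f μ = aeval (L x) (Lagrange.basis f.support id μ) 1 := by
    intro μ hμ
    rw [← hsum', map_sum]
    simp only [hpol]
    rw [Finset.sum_eq_single_of_mem μ hμ]
    · have := Lagrange.eval_basis_self (v := (id : ℝ → ℝ)) Function.injective_id.injOn hμ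
      rw [id] at this
      rw [this, one_smul]
    · intro ν hν hne
      have := Lagrange.eval_basis_of_ne (v := (id : ℝ → ℝ)) (i := μ) hne.symm hν
      rw [id] at this
      rw [this, zero_smul]
  have hmul : ∀ μ ∈ f.support, ∀ ν ∈ f.support, f μ * f ν = if μ = ν then f μ else 0 := by
    intro μ hμ ν hν
    have h := aeval_mul_aeval x (Lagrange.basis f.support id μ) (Lagrange.basis f.support id ν)
    rw [← hlag μ hμ, ← hlag ν hν, hpol] at h
    rw [h]
    split_ifs with e
    · subst e
      have := Lagrange.eval_basis_self (v := (id : ℝ → ℝ)) Function.injective_id.injOn hμ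
      rw [id] at this
      rw [this, one_smul]
    · have := Lagrange.eval_basis_of_ne (v := (id : ℝ → ℝ)) (i := ν) (Ne.symm e) hμ
      rw [id] at this
      rw [this, zero_smul]
  let e := f.support.equivFin.symm
  refine ⟨f.support.card, fun i => f (e i), fun i => e i, ⟨?_, ?_, ?_, ?_⟩, ?_, ?_, ?_⟩
  · exact fun i => Finsupp.mem_support_iff.1 (e i).2
  · intro i
    rw [hmul _ (e i).2 _ (e i).2, if_pos rfl]
  · intro i j hij
    rw [hmul _ (e i).2 _ (e j).2, if_neg]
    exact fun h => hij (e.injective (Subtype.ext h))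
  · rw [e.sum_comp (fun s => f (s : ℝ)), Finset.sum_coe_sort f.support (fun s => f s), hsum']
  · exact fun i j h => e.injective (Subtype.ext h)
  · exact fun i => hev _
  · exact fun i => ⟨_, hlag _ (e i).2⟩

theorem eq_sum_of_mul_eq {m : ℕ} {v : Fin m → V} {a : Fin m → ℝ} (hv : IsSystem v) {x : V}
    (hx : ∀ i, x * v i = a i • v i) : x = ∑ i, a i • v i := by
  conv_lhs => rw [← mul_one x, ← hv.sum_eq, Finset.mul_sum]
  exact Finset.sum_congr rfl fun i _ => hx i

theorem degree_le_finrank (hB : IsInvariantForm B) (x : V) : degree x ≤ Module.finrank ℝ V := by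
  obtain ⟨m, v, a, hv, ha, hx, -⟩ := exists_spectral hB x
  rw [eq_sum_of_mul_eq hv hx, hv.degree_sum ha]
  exact hv.card_le

theorem bddAbove_degree (hB : IsInvariantForm B) : BddAbove (Set.range (degree : V → ℕ)) :=
  ⟨_, by rintro _ ⟨x, rfl⟩; exact degree_le_finrank hB x⟩

theorem degree_le_rank (hB : IsInvariantForm B) (x : V) : degree x ≤ rank V :=
  le_csSup (bddAbove_degree hB) ⟨x, rfl⟩

theorem exists_degree_eq_rank (hB : IsInvariantForm B) : ∃ x : V, degree x = rank V :=
  Nat.sSup_mem (Set.range_nonempty (degree : V → ℕ)) (bddAbove_degree hB)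

theorem IsSystem.le_rank (hB : IsInvariantForm B) {m : ℕ} {c : Fin m → V} (hc : IsSystem c) :
    m ≤ rank V := by
  have ha : Function.Injective (fun i : Fin m => ((i : ℕ) : ℝ)) := fun i j h =>
    Fin.ext (Nat.cast_injective h)
  rw [← hc.degree_sum ha]
  exact degree_le_rank hB _

/-- Splitting an idempotent of a system. -/
theorem IsSystem.split {m : ℕ} {v : Fin m → V} (hv : IsSystem v) (i : Fin m) {a b : V}
    (ha : a * a = a) (hb : b * b = b) (hab : v i = a + b) (ha0 : a ≠ 0) (hb0 : b ≠ 0) :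
    IsSystem (Fin.cons a (Function.update v i b) : Fin (m + 1) → V) := by
  have hmul : a * b = 0 := by
    have h := hv.idem i
    rw [hab, add_mul, mul_add, mul_add, ha, hb, mul_comm b a] at h
    have h2 : (2 : ℝ) • (a * b) = 0 := by
      linear_combination (norm := module) h
    exact (smul_eq_zero.1 h2).resolve_left two_ne_zero
  have hva : v i * a = a := by rw [hab, add_mul, ha, mul_comm b a, hmul, add_zero]
  have hvb : v i * b = b := by rw [hab, add_mul, hb, hmul, zero_add]
  have hao : ∀ j, j ≠ i → a * v j = 0 := fun j hj =>
    peirce_mul_one_zero (hv.idem i) hva (hv.orth i j hj.symm)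
  have hbo : ∀ j, j ≠ i → b * v j = 0 := fun j hj =>
    peirce_mul_one_zero (hv.idem i) hvb (hv.orth i j hj.symm)
  have hau : ∀ j, a * Function.update v i b j = 0 := by
    intro j
    by_cases h : j = i
    · subst h; simpa using hmul
    · simpa [h] using hao j h
  refine ⟨?_, ?_, ?_, ?_⟩
  · refine Fin.cases (by simpa using ha0) fun j => ?_
    by_cases h : j = i
    · subst h; simpa using hb0
    · simpa [h] using hv.ne_zero j
  · refine Fin.cases (by simpa using ha) fun j => ?_
    by_cases h : j = i
    · subst h; simpa using hb
    · simpa [h] using hv.idem j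
  · intro j k
    refine Fin.cases ?_ (fun j => ?_) j <;> refine Fin.cases ?_ (fun k => ?_) k
    · simp
    · intro _
      simpa using hau k
    · intro _
      rw [mul_comm]
      simpa using hau j
    · intro hjk
      have hjk' : j ≠ k := fun h => hjk (by rw [h])
      simp only [Fin.cons_succ]
      by_cases h : j = i
      · subst h
        simpa [hjk'.symm] using hbo k hjk'.symm
      · by_cases h' : k = i
        · subst h'
          rw [mul_comm]
          simpa [h] using hbo j h
        · simpa [h, h'] using hv.orth j k hjk'
  · rw [Fin.sum_univ_succ]
    simp only [Fin.cons_zero, Fin.cons_succ]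
    rw [Finset.sum_update_of_mem (Finset.mem_univ i), ← add_assoc, ← hab, ← hv.sum_eq,
      Finset.sdiff_singleton_eq_erase, Finset.add_sum_erase _ _ (Finset.mem_univ i)]

/-- Every system of orthogonal idempotents can be refined to a Jordan frame. -/
theorem IsSystem.exists_frame {m : ℕ} {v : Fin m → V} (hv : IsSystem v) (a : Fin m → ℝ) :
    ∃ (k : ℕ) (c : Fin k → V) (b : Fin k → ℝ), m ≤ k ∧ IsJordanFrame c ∧
      ∑ i, a i • v i = ∑ i, b i • c i := by
  by_cases hp : ∀ i, IsPrimitive (v i)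
  · exact ⟨m, v, a, le_rfl, ⟨hp, hv.orth, hv.sum_eq⟩, rfl⟩
  · push Not at hp
    obtain ⟨i, hi⟩ := hp
    simp only [IsPrimitive, not_and, not_forall, not_or] at hi
    obtain ⟨e, f, he, hf, hef, he0, hf0⟩ := hi (hv.idem i) (hv.ne_zero i)
    have hs := hv.split i he hf hef he0 hf0
    -- The bound `m + 1 ≤ dim V` makes `dim V - m` drop, so the splitting terminates.
    have hle := hs.card_le
    obtain ⟨k, c, b, hk, hc, hsum⟩ :=
      hs.exists_frame (Fin.cons (a i) a)
    refine ⟨k, c, b, by omega, hc, ?_⟩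
    rw [← hsum, Fin.sum_univ_succ]
    simp only [Fin.cons_zero, Fin.cons_succ]
    have : ∀ j, a j • Function.update v i f j = Function.update (fun j => a j • v j) i (a i • f) j := by
      intro j
      by_cases h : j = i
      · subst h; simp
      · simp [h]
    simp only [this]
    rw [Finset.sum_update_of_mem (Finset.mem_univ i), ← add_assoc, ← smul_add, ← hef,
      Finset.sdiff_singleton_eq_erase, Finset.add_sum_erase _ (fun j => a j • v j) (Finset.mem_univ i)]
termination_by Module.finrank ℝ V - m

theorem exists_frame_of (hB : IsInvariantForm B) (x : V) :
    ∃ (k : ℕ) (c : Fin k → V) (b : Fin k → ℝ), degree x ≤ k ∧ IsJordanFrame c ∧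
      x = ∑ i, b i • c i := by
  obtain ⟨m, v, a, hv, ha, hx, -⟩ := exists_spectral hB x
  obtain ⟨k, c, b, hk, hc, hs⟩ := hv.exists_frame a
  have hx' := eq_sum_of_mul_eq hv hx
  exact ⟨k, c, b, by rw [hx', hv.degree_sum ha]; exact hk, hc, hx'.trans hs⟩

theorem exists_frame_rank (hB : IsInvariantForm B) : ∃ c : Fin (rank V) → V, IsJordanFrame c := by
  obtain ⟨x, hx⟩ := exists_degree_eq_rank hB (V := V)
  obtain ⟨k, c, b, hk, hc, -⟩ := exists_frame_of hB x
  have : k = rank V := le_antisymm (hc.isSystem.le_rank hB) (hx ▸ hk)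
  subst this
  exact ⟨c, hc⟩

/-- If `c` is primitive, the Peirce space `V_1(c)` is the line `ℝ c`. -/
theorem IsPrimitive.exists_smul (hB : IsInvariantForm B) {c : V} (hc : IsPrimitive c) {x : V}
    (hx : c * x = x) : ∃ a : ℝ, x = a • c := by
  have hcc : c * c = c := hc.1
  obtain ⟨m, v, a, hv, ha, hxv, hpol⟩ := exists_spectral hB x
  have hcomm : Commute (L c) (L x) := by
    ext y
    exact commute_of_one hcc hx y
  -- If `a i ≠ 0`, then `v i` is a multiple of `p(x) x`, hence lies in `V_1(c)`. So `c - v i` is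
  -- again idempotent, and primitivity forces `v i = c`.
  have key : ∀ i, ∃ t : ℝ, a i • v i = t • c := by
    intro i
    by_cases h0 : a i = 0
    · exact ⟨0, by simp [h0]⟩
    obtain ⟨p, hp⟩ := hpol i
    have hcp : Commute (L c) (Polynomial.aeval (L x) p) :=
      Algebra.commute_of_mem_adjoin_singleton_of_commute
        (Polynomial.aeval_mem_adjoin_singleton ℝ (L x)) hcomm
    have hxp : Commute (L x) (Polynomial.aeval (L x) p) :=
      Algebra.commute_of_mem_adjoin_singleton_of_commute
        (Polynomial.aeval_mem_adjoin_singleton ℝ (L x)) (Commute.refl _)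
    have e1 : a i • v i = Polynomial.aeval (L x) p x := by
      rw [← hxv i, hp]
      have := LinearMap.congr_fun hxp.eq 1
      simpa using this
    have e2 : c * (a i • v i) = a i • v i := by
      rw [e1]
      have := LinearMap.congr_fun hcp.eq x
      simpa [hx] using this
    have e3 : c * v i = v i := by
      rw [mul_smul_comm] at e2
      exact smul_right_injective V h0 e2
    have e4 : (c - v i) * (c - v i) = c - v i := by
      rw [sub_mul, mul_sub, mul_sub, hcc, e3, mul_comm (v i) c, e3, hv.idem]
      abel
    rcases hc.2.2 (v i) (c - v i) (hv.idem i) e4 (by abel) with h | h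
    · exact absurd h (hv.ne_zero i)
    · exact ⟨a i, by rw [sub_eq_zero.1 h]⟩
  choose t ht using key
  refine ⟨∑ i, t i, ?_⟩
  rw [eq_sum_of_mul_eq hv hxv, Finset.sum_smul]
  exact Finset.sum_congr rfl fun i _ => ht i

end Spectral

end EJA

namespace EJA

/-! ### Joint Peirce decomposition for a system. -/

section PeirceSpaces

variable {V : Type*} [NonAssocCommRing V] [Module ℝ V] [SMulCommClass ℝ V V]
  [IsScalarTower ℝ V V] [IsCommJordan V] {m : ℕ} {c : Fin m → V}

theorem mem_peirceSpace {i j : Fin m} {x : V} :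
    x ∈ peirceSpace c i j ↔ c i * x = (1 / 2 : ℝ) • x ∧ c j * x = (1 / 2 : ℝ) • x := by
  rw [peirceSpace, Submodule.mem_inf, Module.End.mem_eigenspace_iff, Module.End.mem_eigenspace_iff,
    L_apply, L_apply]

theorem mem_peirceSpace_swap {i j : Fin m} {x : V} (hx : x ∈ peirceSpace c i j) :
    x ∈ peirceSpace c j i :=
  mem_peirceSpace.2 (mem_peirceSpace.1 hx).symm

theorem add_mul_of_mem_peirceSpace {i j : Fin m} {e : V} (he : e ∈ peirceSpace c i j) :
    (c i + c j) * e = e := by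
  obtain ⟨h1, h2⟩ := mem_peirceSpace.1 he
  rw [add_mul, h1, h2]
  module

namespace IsSystem

theorem add_idem (hc : IsSystem c) {i j : Fin m} (hij : i ≠ j) :
    (c i + c j) * (c i + c j) = c i + c j := by
  rw [add_mul, mul_add, mul_add, hc.idem, hc.idem, hc.orth i j hij, hc.orth j i hij.symm]
  abel

theorem mul_eq_zero_of_mem (hc : IsSystem c) {i j : Fin m} (hij : i ≠ j) {e x : V}
    (he : e ∈ peirceSpace c i j) (hx : (c i + c j) * x = 0) : e * x = 0 :=
  peirce_mul_one_zero (hc.add_idem hij) (add_mul_of_mem_peirceSpace he) hx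

theorem idem_mul_of_mem (hc : IsSystem c) {i j k : Fin m} (hij : i ≠ j) (hki : k ≠ i)
    (hkj : k ≠ j) {e : V} (he : e ∈ peirceSpace c i j) : c k * e = 0 := by
  rw [mul_comm]
  refine hc.mul_eq_zero_of_mem hij he ?_
  rw [add_mul, hc.orth i k hki.symm, hc.orth j k hkj.symm, add_zero]

theorem idem_mul_eq (hc : IsSystem c) {i j : Fin m} (hij : i ≠ j) (k : Fin m) {e : V}
    (he : e ∈ peirceSpace c i j) :
    c k * e = (if k = i then (1 / 2 : ℝ) • e else 0) + (if k = j then (1 / 2 : ℝ) • e else 0) := by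
  by_cases h1 : k = i
  · subst h1; simp [hij, (mem_peirceSpace.1 he).1]
  by_cases h2 : k = j
  · subst h2; simp [h1, (mem_peirceSpace.1 he).2]
  simp [h1, h2, hc.idem_mul_of_mem hij h1 h2 he]

theorem sum_mul_of_mem (hc : IsSystem c) {i j : Fin m} (hij : i ≠ j) (a : Fin m → ℝ) {e : V}
    (he : e ∈ peirceSpace c i j) : (∑ k, a k • c k) * e = ((a i + a j) / 2) • e := by
  simp only [Finset.sum_mul, smul_mul_assoc, hc.idem_mul_eq hij _ he, smul_add, smul_ite,
    smul_zero, Finset.sum_add_distrib, Finset.sum_ite_eq', Finset.mem_univ, if_true]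
  module

/-- The polarized quadratic representation `P(c_i, c_j)`, for an orthogonal system. -/
noncomputable def proj (c : Fin m → V) (i j : Fin m) : Module.End ℝ V :=
  (2 : ℝ) • (L (c i) * L (c j)) - L (c i * c j)

theorem proj_apply (i j : Fin m) (x : V) :
    proj c i j x = (2 : ℝ) • (c i * (c j * x)) - c i * c j * x := rfl

theorem sum_proj (hc : IsSystem c) (i : Fin m) : ∑ j, proj c i j = L (c i) := by
  ext x
  simp only [LinearMap.sum_apply, proj_apply, Finset.sum_sub_distrib, ← Finset.smul_sum,
    ← Finset.mul_sum, ← Finset.sum_mul, hc.sum_eq, one_mul, mul_one, L_apply]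
  module

theorem sum_sum_proj (hc : IsSystem c) : ∑ i, ∑ j, proj c i j = 1 := by
  simp only [hc.sum_proj]
  ext x
  simp [← Finset.sum_mul, hc.sum_eq]

theorem idem_mul_proj_self (hc : IsSystem c) (i : Fin m) (x : V) :
    c i * proj c i i x = proj c i i x := by
  have h := peirce_cubic (hc.idem i) x
  rw [proj_apply, hc.idem, mul_sub, mul_smul_comm]
  linear_combination (norm := module) h

theorem proj_apply_of_ne (hc : IsSystem c) {i j : Fin m} (hij : i ≠ j) (x : V) :
    proj c i j x = (2 : ℝ) • (c i * (c j * x)) := by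
  rw [proj_apply, hc.orth i j hij, zero_mul, sub_zero]

theorem idem_mul_idem_comm (hc : IsSystem c) (i j : Fin m) (x : V) :
    c i * (c j * x) = c j * (c i * x) := by
  by_cases h : i = j
  · rw [h]
  · exact commute_of_zero (hc.idem i) (hc.orth i j h) x

theorem proj_mem (hc : IsSystem c) {i j : Fin m} (hij : i ≠ j) (x : V) :
    proj c i j x ∈ peirceSpace c i j := by
  have key : ∀ i j : Fin m, i ≠ j → c i * (c i * (c j * x)) = (1 / 2 : ℝ) • (c i * (c j * x)) := by
    intro i j hij
    have h := jordan_mul (c i) (c i) (c j) x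
    rw [hc.idem, hc.orth i j hij, hc.idem_mul_idem_comm j i] at h
    simp only [zero_mul] at h
    linear_combination (norm := module) (1 / 2 : ℝ) • h
  rw [hc.proj_apply_of_ne hij, mem_peirceSpace]
  refine ⟨?_, ?_⟩
  · rw [mul_smul_comm, key i j hij, smul_comm]
  · rw [hc.idem_mul_idem_comm i j x, mul_smul_comm, key j i hij.symm, smul_comm]

/-- The factor `1/2` appears because the ordered pairs `(i, j)` and `(j, i)` each carry half of the
projection onto `V_ij`. -/
theorem proj_apply_of_mem (hc : IsSystem c) {i j : Fin m} (hij : i ≠ j) {x : V}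
    (hx : x ∈ peirceSpace c i j) : proj c i j x = (1 / 2 : ℝ) • x := by
  obtain ⟨h1, h2⟩ := mem_peirceSpace.1 hx
  rw [hc.proj_apply_of_ne hij, h2, mul_smul_comm, h1]
  module

theorem P_sum (hc : IsSystem c) (a : Fin m → ℝ) :
    P (∑ i, a i • c i) = ∑ i, ∑ j, (a i * a j) • proj c i j := by
  ext x
  simp only [P, LinearMap.sub_apply, LinearMap.smul_apply, Module.End.mul_apply, L_apply,
    LinearMap.sum_apply, proj_apply, Finset.sum_mul, Finset.mul_sum, smul_mul_assoc,
    mul_smul_comm, Finset.smul_sum, smul_sub, Finset.sum_sub_distrib]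
  congr 1
  · rw [Finset.sum_comm]
    refine Finset.sum_congr rfl fun i _ => Finset.sum_congr rfl fun j _ => ?_
    rw [hc.idem_mul_idem_comm]
    module
  · rw [Finset.sum_comm]
    refine Finset.sum_congr rfl fun i _ => Finset.sum_congr rfl fun j _ => ?_
    rw [mul_comm (c i)]
    module

end IsSystem

end PeirceSpaces

/-! ### Peirce spaces of a Jordan frame in a simple algebra. -/

section Frames

variable {V : Type*} [NonAssocCommRing V] [Module ℝ V] [SMulCommClass ℝ V V]
  [IsScalarTower ℝ V V] [IsCommJordan V] [FiniteDimensional ℝ V]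
  {B : V →ₗ[ℝ] V →ₗ[ℝ] ℝ} {m : ℕ} {c : Fin m → V}

namespace IsJordanFrame

theorem proj_self_apply (hB : IsInvariantForm B) (hc : IsJordanFrame c) (i : Fin m) (x : V) :
    ∃ a : ℝ, IsSystem.proj c i i x = a • c i :=
  (hc.1 i).exists_smul hB (hc.isSystem.idem_mul_proj_self i x)

/-- Operators are determined by their values on the Peirce spaces. -/
theorem end_ext (hB : IsInvariantForm B) (hc : IsJordanFrame c) {f g : Module.End ℝ V}
    (h1 : ∀ i, f (c i) = g (c i))
    (h2 : ∀ i j, i ≠ j → ∀ e ∈ peirceSpace c i j, f e = g e) : f = g := by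
  ext x
  have hx : x = ∑ i, ∑ j, IsSystem.proj c i j x := by
    have := LinearMap.congr_fun hc.isSystem.sum_sum_proj x
    simpa using this.symm
  rw [hx]
  simp only [map_sum]
  refine Finset.sum_congr rfl fun i _ => Finset.sum_congr rfl fun j _ => ?_
  by_cases hij : i = j
  · subst hij
    obtain ⟨a, ha⟩ := hc.proj_self_apply hB i x
    rw [ha, map_smul, map_smul, h1]
  · exact h2 i j hij _ (hc.isSystem.proj_mem hij x)

/-- Primitivity gives `e² = a c_i + b c_j`, and invariance of `B` gives the two norm relations. Then
`e² e = ((a+b)/2) e`, and the `c_i` coefficient of `e² e² = e (e² e)` reads `a² = a (a+b)/2`, so `a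
= b`. -/
theorem mul_self_of_mem (hB : IsInvariantForm B) (hc : IsJordanFrame c) {i j : Fin m}
    (hij : i ≠ j) {e : V} (he : e ∈ peirceSpace c i j) :
    ∃ a : ℝ, e * e = a • (c i + c j) ∧ a * B (c i) (c i) = B e e / 2 ∧
      a * B (c j) (c j) = B e e / 2 := by
  by_cases he0 : e = 0
  · exact ⟨0, by simp [he0]⟩
  have hs := hc.isSystem
  obtain ⟨h1, h2⟩ := mem_peirceSpace.1 he
  obtain ⟨a, ha⟩ := (hc.1 i).exists_smul hB (peirce_mul_half_half (hs.idem i) h1 h1)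
  obtain ⟨b, hb⟩ := (hc.1 j).exists_smul hB (peirce_mul_half_half (hs.idem j) h2 h2)
  have hee : e * e = a • c i + b • c j := by
    have := peirce_mul_one_one (hs.add_idem hij) (add_mul_of_mem_peirceSpace he)
      (add_mul_of_mem_peirceSpace he)
    rw [← this, add_mul, ha, hb]
  have hci : c i ≠ 0 := hs.ne_zero i
  have hBij : B (c j) (c i) = 0 := by
    have := hB.inv (c j) (c j) (c i)
    rw [hs.idem, hs.orth j i hij.symm, map_zero] at this
    exact this
  have hBji : B (c i) (c j) = 0 := by rw [hB.symm, hBij]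
  have e1 : a * B (c i) (c i) = B e e / 2 := by
    have := hB.inv e e (c i)
    rw [hee, mul_comm e, h1] at this
    simp [hBij] at this
    linarith
  have e2 : b * B (c j) (c j) = B e e / 2 := by
    have := hB.inv e e (c j)
    rw [hee, mul_comm e, h2] at this
    simp [hBji] at this
    linarith
  have ha0 : a ≠ 0 := by
    rintro rfl
    have := hB.pos e he0
    linarith
  have h3 : e * e * (e * e) = e * (e * e * e) := IsJordan.lmul_lmul_comm_lmul e e
  have h4 : e * e * e = ((a + b) / 2) • e := by
    rw [hee, add_mul, smul_mul_assoc, smul_mul_assoc, h1, h2]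
    module
  rw [h4, mul_smul_comm, hee, mul_add, add_mul, add_mul] at h3
  simp only [smul_mul_assoc, mul_smul_comm, hs.idem, hs.orth i j hij, hs.orth j i hij.symm,
    smul_zero, add_zero, zero_add] at h3
  have h5 := congrArg (fun z => c i * z) h3
  simp only [mul_add, mul_smul_comm, hs.idem, hs.orth i j hij, smul_zero, add_zero] at h5
  have h6 : (a * a - (a + b) / 2 * a) • c i = 0 := by
    linear_combination (norm := module) h5
  have h7 := (smul_eq_zero.1 h6).resolve_right hci
  have h8 : a * (a - b) = 0 := by linarith
  have h9 : a = b := sub_eq_zero.1 ((mul_eq_zero.1 h8).resolve_left ha0)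
  subst h9
  exact ⟨a, by rw [hee, smul_add], e1, e2⟩

theorem mul_mem_of_mem (hc : IsJordanFrame c) {i j k : Fin m} (hij : i ≠ j)
    (hki : k ≠ i) (hkj : k ≠ j) {e x : V} (he : e ∈ peirceSpace c i j)
    (hx : x ∈ peirceSpace c i k) : e * x ∈ peirceSpace c j k := by
  have hs := hc.isSystem
  refine mem_peirceSpace.2 ⟨?_, ?_⟩
  · exact peirce_mul_half_zero (hs.idem j) (mem_peirceSpace.1 he).2
      (hs.idem_mul_of_mem hki.symm hij.symm hkj.symm hx)
  · rw [mul_comm e]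
    exact peirce_mul_half_zero (hs.idem k) (mem_peirceSpace.1 hx).2
      (hs.idem_mul_of_mem hij hki hkj he)

/-- The linearized identity with entries `e, c_j, e`, where `c_j` kills both `x` and `e (e x)`. It
makes `L e : V_ik → V_jk` injective when `e ≠ 0`. -/
theorem mul_mul_of_mem (hc : IsJordanFrame c) {i j k : Fin m}
    (hij : i ≠ j) (hki : k ≠ i) (hkj : k ≠ j) {e x : V} (he : e ∈ peirceSpace c i j)
    (hx : x ∈ peirceSpace c i k) {a : ℝ} (ha : e * e = a • (c i + c j)) :
    e * (e * x) = (a / 4) • x := by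
  have hs := hc.isSystem
  have h1 : e * (e * x) ∈ peirceSpace c i k :=
    hc.mul_mem_of_mem hij.symm hkj hki (mem_peirceSpace_swap he)
      (hc.mul_mem_of_mem hij hki hkj he hx)
  have h2 : c j * (e * (e * x)) = 0 := hs.idem_mul_of_mem hki.symm hij.symm hkj.symm h1
  have h3 : c j * x = 0 := hs.idem_mul_of_mem hki.symm hij.symm hkj.symm hx
  have h4 : c i * x = (1 / 2 : ℝ) • x := (mem_peirceSpace.1 hx).1
  have h5 : c j * e = (1 / 2 : ℝ) • e := (mem_peirceSpace.1 he).2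
  have h := jordan_mul e (c j) e x
  rw [mul_comm e (c j), h5, h2, h3, ha] at h
  simp only [smul_mul_assoc, ha, add_mul, h3, h4, mul_zero, smul_add, smul_zero] at h
  linear_combination (norm := module) -h

theorem finrank_peirceSpace_le (hB : IsInvariantForm B) (hc : IsJordanFrame c) {i j k : Fin m}
    (hij : i ≠ j) (hki : k ≠ i) (hkj : k ≠ j) (hne : peirceSpace c i j ≠ ⊥) :
    Module.finrank ℝ (peirceSpace c i k) ≤ Module.finrank ℝ (peirceSpace c j k) := by
  obtain ⟨e, he, he0⟩ := Submodule.exists_mem_ne_zero_of_ne_bot hne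
  obtain ⟨a, ha, ha1, -⟩ := hc.mul_self_of_mem hB hij he
  have ha0 : a ≠ 0 := by
    rintro rfl
    have := hB.pos e he0
    linarith
  let f : peirceSpace c i k →ₗ[ℝ] peirceSpace c j k :=
    (L e).restrict fun x hx => hc.mul_mem_of_mem hij hki hkj he hx
  refine LinearMap.finrank_le_finrank_of_injective (f := f) ?_
  rw [← LinearMap.ker_eq_bot, LinearMap.ker_eq_bot']
  intro x hx
  have h0 : e * (x : V) = 0 := congrArg Subtype.val hx
  have := hc.mul_mul_of_mem hij hki hkj he x.2 ha
  rw [h0, mul_zero] at this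
  have h1 : a / 4 ≠ 0 := by positivity
  exact Subtype.ext ((smul_eq_zero.1 this.symm).resolve_left h1)

theorem peirceSpace_comm (i j : Fin m) : peirceSpace c i j = peirceSpace c j i :=
  inf_comm _ _

theorem finrank_peirceSpace_eq (hB : IsInvariantForm B) (hc : IsJordanFrame c) {i j k : Fin m}
    (hij : i ≠ j) (hki : k ≠ i) (hkj : k ≠ j) (hne : peirceSpace c i j ≠ ⊥) :
    Module.finrank ℝ (peirceSpace c i k) = Module.finrank ℝ (peirceSpace c j k) :=
  le_antisymm (hc.finrank_peirceSpace_le hB hij hki hkj hne)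
    (hc.finrank_peirceSpace_le hB hij.symm hkj hki (by rwa [peirceSpace_comm]))

/-- In a simple algebra all off-diagonal Peirce spaces are nonzero. -/
theorem peirceSpace_ne_bot (hB : IsInvariantForm B) (hS : IsSimple V) (hc : IsJordanFrame c)
    {i j : Fin m} (hij : i ≠ j) : peirceSpace c i j ≠ ⊥ := by
  classical
  have hs := hc.isSystem
  intro hbot
  -- Indices joined to `i` by a nonzero Peirce space. Direct neighbours already form a connected
  -- component, since `finrank_peirceSpace_eq` makes the relation transitive.
  let conn : Fin m → Prop := fun k => k = i ∨ peirceSpace c i k ≠ ⊥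
  have hmix : ∀ k l, conn k → ¬ conn l → peirceSpace c k l = ⊥ := by
    intro k l hk hl
    simp only [conn, not_or, not_not] at hl
    by_cases hki : k = i
    · rw [hki]; exact hl.2
    · have hk' := hk.resolve_left hki
      have hkl : l ≠ k := by rintro rfl; exact hk' hl.2
      have := hc.finrank_peirceSpace_eq hB (Ne.symm hki) hl.1 hkl hk'
      rw [hl.2, finrank_bot] at this
      exact Submodule.finrank_eq_zero.1 this.symm
  let a : Fin m → ℝ := fun k => if conn k then 1 else 0
  have haa : ∀ k, a k * a k = a k := by intro k; by_cases h : conn k <;> simp [a, h]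
  let u : V := ∑ k, a k • c k
  have huu : u * u = u := by
    simp only [u, hs.sum_mul_sum, haa]
  -- With no Peirce space joining the component to its complement, `L u` has no eigenvalue `1/2`.
  -- Hence `V_1(u)` is an ideal; it contains `c i` but not `c j`.
  have hLu : L u * L u = L u := by
    refine hc.end_ext hB (fun k => ?_) (fun k l hkl e he => ?_)
    · simp only [Module.End.mul_apply, L_apply]
      have : u * c k = a k • c k := by rw [mul_comm]; exact hs.mul_sum k a
      rw [this, mul_smul_comm, this, smul_smul, haa]
    · simp only [Module.End.mul_apply, L_apply]
      have hue : u * e = ((a k + a l) / 2) • e := hs.sum_mul_of_mem hkl a he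
      rw [hue, mul_smul_comm, hue, smul_smul]
      by_cases hk : conn k <;> by_cases hl : conn l
      · simp [a, hk, hl]
      · have : e = 0 := by rw [hmix k l hk hl] at he; simpa using he
        simp [this]
      · have : e = 0 := by
          rw [peirceSpace_comm, hmix l k hl hk] at he; simpa using he
        simp [this]
      · simp [a, hk, hl]
  have hLu' : ∀ x, u * (u * x) = u * x := fun x => LinearMap.congr_fun hLu x
  let I : Submodule ℝ V := Module.End.eigenspace (L u) 1
  have hI : ∀ x, x ∈ I ↔ u * x = x := by
    intro x
    rw [Module.End.mem_eigenspace_iff, one_smul, L_apply]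
  have hid : ∀ x y : V, y ∈ I → x * y ∈ I := by
    intro x y hy
    rw [hI] at hy ⊢
    have h0 : y * (x - u * x) = 0 :=
      peirce_mul_one_zero huu hy (by rw [mul_sub, hLu', sub_self])
    have h1 : x * y = u * x * y := by
      rw [mul_comm y, sub_mul] at h0
      exact sub_eq_zero.1 h0
    rw [h1]
    exact peirce_mul_one_one huu (hLu' x) hy
  have hui : u * c i = c i := by
    rw [mul_comm, hs.mul_sum i a]
    simp [a, conn]
  rcases hS.2 I hid with h | h
  · have : c i ∈ I := (hI _).2 hui
    rw [h] at this
    exact hs.ne_zero i (by simpa using this)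
  · have : c j ∈ I := h ▸ Submodule.mem_top
    rw [hI, mul_comm, hs.mul_sum j a] at this
    have haj : a j = 0 := by simp [a, conn, hij.symm, hbot]
    rw [haj, zero_smul] at this
    exact hs.ne_zero j this.symm

theorem finrank_peirceSpace_const (hB : IsInvariantForm B) (hS : IsSimple V)
    (hc : IsJordanFrame c) {i j k l : Fin m} (hij : i ≠ j) (hkl : k ≠ l) :
    Module.finrank ℝ (peirceSpace c i j) = Module.finrank ℝ (peirceSpace c k l) := by
  have step : ∀ {i j k : Fin m}, i ≠ j → k ≠ j →
      Module.finrank ℝ (peirceSpace c i j) = Module.finrank ℝ (peirceSpace c k j) := by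
    intro i j k hij hkj
    by_cases hik : i = k
    · rw [hik]
    · exact hc.finrank_peirceSpace_eq hB hik hij.symm hkj.symm (hc.peirceSpace_ne_bot hB hS hik)
  by_cases hkj : k = j
  · subst hkj
    by_cases hil : i = l
    · subst hil; rw [peirceSpace_comm]
    · rw [peirceSpace_comm i k, peirceSpace_comm k l]
      rw [peirceSpace_comm k i]
      exact step hij hkl.symm
  · rw [step hij hkj, peirceSpace_comm k j, peirceSpace_comm k l]
    exact step (Ne.symm hkj) hkl.symm

theorem form_const (hB : IsInvariantForm B) (hS : IsSimple V) (hc : IsJordanFrame c)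
    (i j : Fin m) : B (c i) (c i) = B (c j) (c j) := by
  by_cases hij : i = j
  · rw [hij]
  obtain ⟨e, he, he0⟩ := Submodule.exists_mem_ne_zero_of_ne_bot (hc.peirceSpace_ne_bot hB hS hij)
  obtain ⟨a, -, h1, h2⟩ := hc.mul_self_of_mem hB hij he
  have ha0 : a ≠ 0 := by
    rintro rfl
    have := hB.pos e he0
    linarith
  exact mul_left_cancel₀ ha0 (h1.trans h2.symm)

end IsJordanFrame

end Frames

end EJA

namespace EJA

/-! ### Equal norms and lengths of frames; identification of the trace. -/

section FrameSize

variable {V : Type*} [NonAssocCommRing V] [Module ℝ V] [SMulCommClass ℝ V V]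
  [IsScalarTower ℝ V V] [IsCommJordan V] [FiniteDimensional ℝ V]
  {B : V →ₗ[ℝ] V →ₗ[ℝ] ℝ}

theorem P_apply (e x : V) : P e x = (2 : ℝ) • (e * (e * x)) - e * e * x := rfl

theorem P_apply_of_half {e x : V} (he : e * e = e) (hx : e * x = (1 / 2 : ℝ) • x) :
    P e x = 0 := by
  rw [P_apply, he, hx, mul_smul_comm, hx]
  module

theorem P_apply_of_zero {e x : V} (he : e * e = e) (hx : e * x = 0) : P e x = 0 := by
  rw [P_apply, he, hx, mul_zero, smul_zero, sub_zero]

theorem P_apply_self {e : V} (he : e * e = e) : P e e = e := by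
  rw [P_apply, he, he]
  module

/-- Split `f = a e + h + z` along the Peirce spaces `V_1`, `V_1/2`, `V_0` of `e`. The `V_1` part of
`f² = f` gives `P e (h²) = (a - a²) e`, which is all that is needed to project `P f e`. -/
theorem P_P_apply {e f : V} (he : e * e = e) (hf : f * f = f) {a : ℝ} (ha : P e f = a • e) :
    P e (P f e) = (a * a) • e := by
  -- `4 (t - t²)` is `1` at `t = 1/2` and `0` at `t = 0, 1`, so this is the `V_1/2` component.
  obtain ⟨h, hh⟩ : ∃ h : V, h = (4 : ℝ) • (e * f - e * (e * f)) := ⟨_, rfl⟩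
  obtain ⟨z, hz⟩ : ∃ z : V, z = f - a • e - h := ⟨_, rfl⟩
  have hcub := peirce_cubic he f
  have ha' : a • e = (2 : ℝ) • (e * (e * f)) - e * f := by rw [← ha, P_apply, he]
  have eh : e * h = (1 / 2 : ℝ) • h := by
    rw [hh, mul_smul_comm, mul_sub]
    linear_combination (norm := module) (-2 : ℝ) • hcub
  have ez : e * z = 0 := by
    rw [hz, mul_sub, mul_sub, mul_smul_comm, he, eh, ha', hh]
    module
  have hfd : f = a • e + h + z := by rw [hz]; abel
  have hhz : P e (h * z) = 0 := P_apply_of_half he (peirce_mul_half_zero he eh ez)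
  have hPh : P e h = 0 := P_apply_of_half he eh
  have hPe : P e e = e := P_apply_self he
  have hPz : P e z = 0 := P_apply_of_zero he ez
  have hzz : P e (z * z) = 0 := by
    refine P_apply_of_zero he ?_
    have := peirce_mul he (x := z) (y := z) (a := 0) (b := 0) (by simpa using ez)
      (by simpa using ez) (by norm_num)
    simpa using this
  have hff : f * f = (a * a) • e + a • h + h * h + (2 : ℝ) • (h * z) + z * z := by
    rw [hfd]
    simp only [add_mul, mul_add, smul_mul_assoc, mul_smul_comm, he, eh, ez, mul_comm h e,
      mul_comm z e, mul_comm z h]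
    module
  have hPhh : P e (h * h) = (a - a * a) • e := by
    have := congrArg (P e) hff
    rw [hf, ha] at this
    simp only [map_add, map_smul, hhz, hPh, hPe, hzz] at this
    linear_combination (norm := module) -this
  have hfe : f * e = a • e + (1 / 2 : ℝ) • h := by
    rw [hfd]
    simp only [add_mul, smul_mul_assoc, he, mul_comm h e, mul_comm z e, eh, ez]
    module
  have hffe : f * (f * e) = (a * a) • e + (a / 2) • h + (1 / 2 : ℝ) • ((a / 2) • h + h * h + h * z) := by
    rw [hfe, mul_add, mul_smul_comm, mul_smul_comm, hfe]
    have : f * h = (a / 2) • h + h * h + h * z := by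
      rw [hfd]
      simp only [add_mul, smul_mul_assoc, eh, mul_comm z h]
      module
    rw [this]
    module
  rw [P_apply f e, hf, hffe, hfe]
  simp only [map_add, map_sub, map_smul, hhz, hPh, hPe, hPhh]
  module

theorem IsInvariantForm.apply_one (hB : IsInvariantForm B) {e : V} (he : e * e = e) :
    B e 1 = B e e := by
  have := hB.inv e e 1
  rwa [he, mul_one] at this

theorem IsInvariantForm.P_symm (hB : IsInvariantForm B) (e x y : V) :
    B (P e x) y = B x (P e y) := by
  simp only [P_apply, map_sub, map_smul, LinearMap.sub_apply, LinearMap.smul_apply, hB.inv]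

/-- Non-orthogonal primitive idempotents have the same norm. -/
theorem IsPrimitive.form_eq (hB : IsInvariantForm B) {e f : V} (he : IsPrimitive e)
    (hf : IsPrimitive f) (hef : B e f ≠ 0) : B e e = B f f := by
  have hee : e * e = e := he.1
  have hff : f * f = f := hf.1
  have hmem : ∀ {e f : V}, e * e = e → e * P e f = P e f := by
    intro e f hee
    have h := peirce_cubic hee f
    rw [P_apply, hee, mul_sub, mul_smul_comm]
    linear_combination (norm := module) h
  obtain ⟨a, ha⟩ := he.exists_smul hB (hmem (f := f) hee)
  obtain ⟨b, hb⟩ := hf.exists_smul hB (hmem (f := e) hff)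
  have h1 : a * B e e = B e f := by
    have := hB.P_symm e f e
    rw [ha, P_apply_self hee] at this
    simpa [hB.symm f e] using this
  have h2 : b * B f f = B e f := by
    have := hB.P_symm f e f
    rw [hb, P_apply_self hff] at this
    simpa using this
  -- With `P e f = a e` and `P f e = b f`, the left side is `a b e`, hence `a = b`; and both `a
  -- |e|²` and `b |f|²` equal `B e f`.
  have h3 := P_P_apply hee hff ha
  rw [hb, map_smul, ha, smul_smul] at h3
  have h4 : b * a = a * a := smul_left_injective ℝ he.2.1 h3
  have ha0 : a ≠ 0 := by
    rintro rfl
    exact hef (by rw [← h1, zero_mul])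
  have h5 : b = a := mul_right_cancel₀ ha0 h4
  rw [h5] at h2
  exact mul_left_cancel₀ ha0 (h1.trans h2.symm)

/-- Since `c i` pairs positively with `1 = ∑ c' l`, it is not orthogonal to some `c' l`; inside one
frame norms agree by `form_const`. -/
theorem IsJordanFrame.form_eq (hB : IsInvariantForm B) (hS : IsSimple V) {m k : ℕ}
    {c : Fin m → V} {c' : Fin k → V} (hc : IsJordanFrame c) (hc' : IsJordanFrame c') (i : Fin m)
    (j : Fin k) : B (c i) (c i) = B (c' j) (c' j) := by
  have h1 : ∑ l, B (c i) (c' l) ≠ 0 := by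
    rw [← map_sum, hc'.2.2, hB.apply_one (hc.1 i).1]
    exact (hB.pos _ (hc.1 i).2.1).ne'
  obtain ⟨l, -, hl⟩ := Finset.exists_ne_zero_of_sum_ne_zero h1
  rw [(hc.1 i).form_eq hB (hc'.1 l) hl]
  exact hc'.form_const hB hS l j

theorem exists_norm_idempotent (hB : IsInvariantForm B) (hS : IsSimple V) :
    ∃ κ : ℝ, 0 < κ ∧ ∀ (m : ℕ) (c : Fin m → V), IsJordanFrame c → ∀ i, B (c i) (c i) = κ := by
  have := hS.1
  obtain ⟨c, hc⟩ := exists_frame_rank hB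
  have hpos : 0 < rank V := by
    by_contra h
    have h0 : rank V = 0 := by omega
    have h1 := hc.2.2
    have : IsEmpty (Fin (rank V)) := by rw [h0]; infer_instance
    rw [Finset.sum_of_isEmpty] at h1
    exact zero_ne_one h1
  exact ⟨_, hB.pos _ (hc.1 ⟨0, hpos⟩).2.1, fun m c' hc' i => hc'.form_eq hB hS hc i ⟨0, hpos⟩⟩

theorem IsJordanFrame.form_one_sum (hB : IsInvariantForm B) {κ : ℝ} {m : ℕ} {c : Fin m → V}
    (hc : IsJordanFrame c) (hκ : ∀ i, B (c i) (c i) = κ) (a : Fin m → ℝ) :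
    B (∑ i, a i • c i) 1 = κ * ∑ i, a i := by
  simp only [map_sum, map_smul, LinearMap.sum_apply, LinearMap.smul_apply,
    hB.apply_one (hc.1 _).1, hκ, smul_eq_mul, Finset.mul_sum]
  exact Finset.sum_congr rfl fun i _ => mul_comm _ _

/-- `B 1 1` is the common norm `κ` times the length of any frame. -/
theorem IsJordanFrame.card_eq_rank (hB : IsInvariantForm B) (hS : IsSimple V) {m : ℕ}
    {c : Fin m → V} (hc : IsJordanFrame c) : m = rank V := by
  obtain ⟨κ, hκ0, hκ⟩ := exists_norm_idempotent hB hS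
  obtain ⟨c', hc'⟩ := exists_frame_rank hB
  have h1 := hc.form_one_sum hB (hκ m c hc) 1
  have h2 := hc'.form_one_sum hB (hκ _ c' hc') 1
  simp only [Pi.one_apply, one_smul, hc.2.2, hc'.2.2, Finset.sum_const, Finset.card_univ,
    Fintype.card_fin, nsmul_eq_mul, mul_one] at h1 h2
  exact_mod_cast mul_left_cancel₀ hκ0.ne' (h1.symm.trans h2)

/-- The minimal polynomial relation in a frame. -/
theorem IsSystem.pow_sub_mem {m : ℕ} {c : Fin m → V} (hc : IsSystem c) (hm : 0 < m)
    (a : Fin m → ℝ) :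
    pow (∑ i, a i • c i) m - (∑ i, a i) • pow (∑ i, a i • c i) (m - 1) ∈
      Submodule.span ℝ {z : V | ∃ k : ℕ, k + 1 < m ∧ z = pow (∑ i, a i • c i) k} := by
  open Polynomial in
  set x := ∑ i, a i • c i with hx
  -- This polynomial annihilates `x`, and its second coefficient is `-∑ a i`.
  set p : ℝ[X] := ∏ i, (X - C (a i)) with hp
  have hdeg : p.natDegree = m := by
    rw [hp, natDegree_finsetProd_X_sub_C_eq_card]; simp
  have hmon : p.Monic := monic_prod_X_sub_C _ _
  have hnext : p.coeff (m - 1) = -∑ i, a i := by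
    rw [← prod_X_sub_C_nextCoeff, ← hp, nextCoeff_of_natDegree_pos (by omega), hdeg]
  have hsum : ∑ k ∈ Finset.range (m + 1), p.coeff k • pow x k = 0 := by
    have h1 : ∑ k ∈ Finset.range (m + 1), p.coeff k • pow x k = ∑ i, (p.eval (a i)) • c i := by
      simp only [hx, hc.pow_sum, Finset.smul_sum, smul_smul, eval_eq_sum_range, hdeg,
        Finset.sum_smul]
      exact Finset.sum_comm
    rw [h1]
    refine Finset.sum_eq_zero fun i _ => ?_
    have : p.eval (a i) = 0 := by
      rw [hp, eval_prod]
      exact Finset.prod_eq_zero (Finset.mem_univ i) (by simp)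
    rw [this, zero_smul]
  obtain ⟨s, rfl⟩ : ∃ s, m = s + 1 := ⟨m - 1, by omega⟩
  have hlead : p.coeff (s + 1) = 1 := by
    have := hmon.coeff_natDegree
    rwa [hdeg] at this
  rw [Finset.sum_range_succ, Finset.sum_range_succ, hlead] at hsum
  simp only [Nat.add_sub_cancel] at hnext ⊢
  rw [hnext] at hsum
  have : pow x (s + 1) - (∑ i, a i) • pow x s = -∑ k ∈ Finset.range s, p.coeff k • pow x k := by
    linear_combination (norm := module) hsum
  rw [this]
  refine Submodule.neg_mem _ (Submodule.sum_mem _ fun k hk => Submodule.smul_mem _ _ ?_)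
  exact Submodule.subset_span ⟨k, by have := Finset.mem_range.1 hk; omega, rfl⟩

theorem IsSystem.trace_unique {m : ℕ} {c : Fin m → V} (hc : IsSystem c) (hm : 0 < m)
    {a : Fin m → ℝ} (ha : Function.Injective a) {t : ℝ}
    (ht : pow (∑ i, a i • c i) m - t • pow (∑ i, a i • c i) (m - 1) ∈
      Submodule.span ℝ {z : V | ∃ k : ℕ, k + 1 < m ∧ z = pow (∑ i, a i • c i) k}) :
    t = ∑ i, a i := by
  have h := Submodule.sub_mem _ (hc.pow_sub_mem hm a) ht
  have hli := hc.linearIndependent_pow ha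
  set x := ∑ i, a i • c i
  by_contra hne
  have h1 : (t - ∑ i, a i) • pow x (m - 1) ∈
      Submodule.span ℝ {z : V | ∃ k : ℕ, k + 1 < m ∧ z = pow x k} := by
    convert h using 1
    module
  rw [Submodule.smul_mem_iff _ (sub_ne_zero.2 hne)] at h1
  have h2 := hli.notMem_span_image (s := {k : Fin m | (k : ℕ) + 1 < m})
    (x := ⟨m - 1, by omega⟩) (by simp; omega)
  refine h2 (Submodule.span_mono ?_ h1)
  rintro _ ⟨k, hk, rfl⟩
  exact ⟨⟨k, by omega⟩, hk, rfl⟩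

theorem isTrace_form (hB : IsInvariantForm B) (hS : IsSimple V) {κ : ℝ} (hκ0 : 0 < κ)
    (hκ : ∀ (m : ℕ) (c : Fin m → V), IsJordanFrame c → ∀ i, B (c i) (c i) = κ) :
    IsTrace (κ⁻¹ • B 1) := by
  intro x _
  have := hS.1
  obtain ⟨m, c, b, -, hc, hx⟩ := exists_frame_of hB x
  have hm := hc.card_eq_rank hB hS
  have hpos : 0 < m := by
    by_contra h
    obtain rfl : m = 0 := by omega
    have h1 := hc.2.2
    rw [Finset.sum_of_isEmpty] at h1
    exact zero_ne_one h1
  have ht : (κ⁻¹ • B 1) x = ∑ i, b i := by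
    rw [LinearMap.smul_apply, hB.symm, hx, hc.form_one_sum hB (hκ m c hc), smul_eq_mul,
      inv_mul_cancel_left₀ hκ0.ne']
  rw [ht, ← hm, hx]
  exact hc.isSystem.pow_sub_mem hpos b

theorem IsTrace.eq_form (hB : IsInvariantForm B) (hS : IsSimple V) {κ : ℝ} (hκ0 : 0 < κ)
    (hκ : ∀ (m : ℕ) (c : Fin m → V), IsJordanFrame c → ∀ i, B (c i) (c i) = κ)
    {t : V →ₗ[ℝ] ℝ} (ht : IsTrace t) : t = κ⁻¹ • B 1 := by
  ext x
  obtain ⟨m, c, b, -, hc, hx⟩ := exists_frame_of hB x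
  have hm := hc.card_eq_rank hB hS
  have key : ∀ a : Fin m → ℝ, Function.Injective a → t (∑ i, a i • c i) = ∑ i, a i := by
    intro a ha
    by_cases hpos : 0 < m
    · refine hc.isSystem.trace_unique hpos ha ?_
      have := ht (∑ i, a i • c i) (by rw [hc.isSystem.degree_sum ha, hm])
      rwa [← hm] at this
    · obtain rfl : m = 0 := by omega
      simp
  have hinj : Function.Injective (fun i : Fin m => ((i : ℕ) : ℝ)) := fun i j h =>
    Fin.ext (Nat.cast_injective h)
  have hti : ∀ i, t (c i) = 1 := by
    intro i
    -- The trace condition only controls distinct coefficients. Comparing `0, …, m-1` with the same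
    -- list raised by `m` at position `i` isolates `t (c i)`.
    have hinj' : Function.Injective
        (fun j : Fin m => ((j : ℕ) : ℝ) + if j = i then (m : ℝ) else 0) := by
      intro j k h
      simp only at h
      have hj : ((j : ℕ) : ℝ) < m := by exact_mod_cast j.2
      have hk : ((k : ℕ) : ℝ) < m := by exact_mod_cast k.2
      have hj0 : (0 : ℝ) ≤ ((j : ℕ) : ℝ) := Nat.cast_nonneg _
      have hk0 : (0 : ℝ) ≤ ((k : ℕ) : ℝ) := Nat.cast_nonneg _
      split_ifs at h with h1 h2 h2
      · rw [h1, h2]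
      · linarith
      · linarith
      · exact hinj (by simpa using h)
    have h1 := key _ hinj
    have h2 := key _ hinj'
    have hm0 : (m : ℝ) ≠ 0 := by
      have := i.2
      have : m ≠ 0 := by omega
      exact_mod_cast this
    simp only [add_smul, Finset.sum_add_distrib, map_add, h1, ite_smul, zero_smul,
      Finset.sum_ite_eq', Finset.mem_univ, if_true, map_smul, smul_eq_mul] at h2
    have h3 : (m : ℝ) * t (c i) = m * 1 := by linarith
    exact mul_left_cancel₀ hm0 h3
  rw [LinearMap.smul_apply, hB.symm, hx, hc.form_one_sum hB (hκ m c hc), smul_eq_mul,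
      inv_mul_cancel_left₀ hκ0.ne']
  simp [hti]

/-- In a simple Euclidean Jordan algebra `tr (x y)` is a positive definite invariant form, and
all Jordan frames are orthonormal with `rank V` elements. -/
theorem exists_trace_form (hE : IsEuclidean V) (hS : IsSimple V) :
    ∃ B : V →ₗ[ℝ] V →ₗ[ℝ] ℝ, IsInvariantForm B ∧ (∀ x y, tr V (x * y) = B x y) ∧
      ∀ (m : ℕ) (c : Fin m → V), IsJordanFrame c → m = rank V ∧ ∀ i, B (c i) (c i) = 1 := by
  obtain ⟨B, h1, h2, h3⟩ := hE
  have hB : IsInvariantForm B := ⟨h1, h2, h3⟩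
  obtain ⟨κ, hκ0, hκ⟩ := exists_norm_idempotent hB hS
  have hex : ∃ t : V →ₗ[ℝ] ℝ, IsTrace t := ⟨_, isTrace_form hB hS hκ0 hκ⟩
  have htr : tr V = κ⁻¹ • B 1 := by
    have : IsTrace (tr V) := by
      rw [tr, dif_pos hex]
      exact hex.choose_spec
    exact this.eq_form hB hS hκ0 hκ
  refine ⟨κ⁻¹ • B, ⟨fun x y => ?_, fun x hx => ?_, fun x y z => ?_⟩, fun x y => ?_,
    fun m c hc => ⟨hc.card_eq_rank hB hS, fun i => ?_⟩⟩
  · simp [hB.symm x y]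
  · have := hB.pos x hx
    simp only [LinearMap.smul_apply, smul_eq_mul]
    positivity
  · simp [hB.inv x y z]
  · have := hB.inv x 1 y
    rw [mul_one] at this
    rw [htr]
    simp [this]
  · simp [hκ m c hc i, hκ0.ne']

end FrameSize

end EJA

namespace EJA

/-! ### Operators attached to a frame and their traces. -/

section PeirceOperators

variable {V : Type*} [NonAssocCommRing V] [Module ℝ V] [SMulCommClass ℝ V V]
  [IsScalarTower ℝ V V] [IsCommJordan V] [FiniteDimensional ℝ V]
  {B : V →ₗ[ℝ] V →ₗ[ℝ] ℝ} {m : ℕ} {c : Fin m → V}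

theorem tensor_apply (htr : ∀ x y, tr V (x * y) = B x y) (a b x : V) :
    tensor a b x = B b x • a := by
  rw [← htr]; rfl

theorem trace_tensor (htr : ∀ x y, tr V (x * y) = B x y) (a b : V) :
    LinearMap.trace ℝ V (tensor a b) = B b a := by
  rw [tensor, LinearMap.trace_smulRight, ← htr]; rfl

theorem IsInvariantForm.eq_zero_of_half_zero (hB : IsInvariantForm B) {e x y : V}
    (hx : e * x = (1 / 2 : ℝ) • x) (hy : e * y = 0) : B x y = 0 := by
  have := hB.inv e x y
  rw [hx, hy] at this
  simpa using this

theorem IsInvariantForm.eq_zero_of_half_one (hB : IsInvariantForm B) {e x y : V}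
    (hx : e * x = (1 / 2 : ℝ) • x) (hy : e * y = y) : B x y = 0 := by
  have := hB.inv e x y
  rw [hx, hy, map_smul, LinearMap.smul_apply, smul_eq_mul] at this
  linarith

theorem IsSystem.form_idem (hB : IsInvariantForm B) (hc : IsSystem c) {i j : Fin m}
    (hij : i ≠ j) : B (c i) (c j) = 0 := by
  have := hB.inv (c i) (c i) (c j)
  rwa [hc.idem, hc.orth i j hij, map_zero] at this

theorem IsSystem.form_of_mem (hB : IsInvariantForm B) (hc : IsSystem c) {i j : Fin m}
    {e : V} (he : e ∈ peirceSpace c i j) (k : Fin m) : B (c k) e = 0 := by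
  rw [hB.symm]
  obtain ⟨h1, h2⟩ := mem_peirceSpace.1 he
  by_cases hki : k = i
  · rw [hki]; exact hB.eq_zero_of_half_one h1 (hc.idem i)
  · exact hB.eq_zero_of_half_zero h1 (hc.orth i k (Ne.symm hki))

theorem IsSystem.proj_symm (hB : IsInvariantForm B) (hc : IsSystem c) (i j : Fin m) (x y : V) :
    B (proj c i j x) y = B x (proj c i j y) := by
  simp only [proj_apply, map_sub, map_smul, LinearMap.sub_apply, LinearMap.smul_apply, hB.inv]
  rw [hc.idem_mul_idem_comm j i]

namespace IsJordanFrame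

theorem mul_self_eq (hB : IsInvariantForm B) (hc : IsJordanFrame c)
    (h1 : ∀ i, B (c i) (c i) = 1) {i j : Fin m} (hij : i ≠ j) {e : V}
    (he : e ∈ peirceSpace c i j) : e * e = (B e e / 2) • (c i + c j) := by
  obtain ⟨a, ha, h2, -⟩ := hc.mul_self_of_mem hB hij he
  rw [h1, mul_one] at h2
  rw [ha, h2]

theorem mul_eq_of_mem (hB : IsInvariantForm B) (hc : IsJordanFrame c)
    (h1 : ∀ i, B (c i) (c i) = 1) {i j : Fin m} (hij : i ≠ j) {e x : V}
    (he : e ∈ peirceSpace c i j) (hx : x ∈ peirceSpace c i j) :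
    e * x = (B e x / 2) • (c i + c j) := by
  have h := hc.mul_self_eq hB h1 hij (Submodule.add_mem _ he hx)
  rw [add_mul, mul_add, mul_add, hc.mul_self_eq hB h1 hij he, hc.mul_self_eq hB h1 hij hx,
    mul_comm x e] at h
  simp only [map_add, LinearMap.add_apply, hB.symm x e] at h
  linear_combination (norm := module) (1 / 2 : ℝ) • h

theorem P_apply_adjacent (hB : IsInvariantForm B) (hc : IsJordanFrame c)
    (h1 : ∀ i, B (c i) (c i) = 1) {i j k : Fin m} (hij : i ≠ j) (hki : k ≠ i) (hkj : k ≠ j)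
    {e x : V} (he : e ∈ peirceSpace c i j) (hx : x ∈ peirceSpace c i k) : P e x = 0 := by
  have hee := hc.mul_self_eq hB h1 hij he
  rw [P_apply, hc.mul_mul_of_mem hij hki hkj he hx hee, hee, smul_mul_assoc, add_mul,
    (mem_peirceSpace.1 hx).1, hc.isSystem.idem_mul_of_mem hki.symm hij.symm hkj.symm hx]
  module

/-- Checked on Peirce components: `P e` exchanges `c_i` and `c_j` up to the factor `B e e / 2`,
sends `x ∈ V_ij` to `B e x • e - (B e e / 2) • x`, and kills the other components. -/
theorem P_of_mem (hB : IsInvariantForm B) (htr : ∀ x y, tr V (x * y) = B x y)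
    (hc : IsJordanFrame c) (h1 : ∀ i, B (c i) (c i) = 1) {i j : Fin m} (hij : i ≠ j) {e : V}
    (he : e ∈ peirceSpace c i j) :
    P e = (B e e / 2) • (tensor (c i) (c j) + tensor (c j) (c i)) + tensor e e -
      (B e e) • IsSystem.proj c i j := by
  have hs := hc.isSystem
  have hee := hc.mul_self_eq hB h1 hij he
  obtain ⟨hi, hj⟩ := mem_peirceSpace.1 he
  refine hc.end_ext hB (fun k => ?_) (fun k l hkl x hx => ?_)
  · simp only [LinearMap.sub_apply, LinearMap.add_apply, LinearMap.smul_apply, tensor_apply htr,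
      hs.proj_apply_of_ne hij, P_apply, hB.symm e (c k), hs.form_of_mem hB he k]
    by_cases hki : k = i
    · subst hki
      rw [mul_comm e (c k), hi, mul_smul_comm, hee, smul_mul_assoc, add_mul, hs.idem,
        mul_comm (c j) (c k), hs.orth k j hij, h1, hs.form_idem hB hij.symm]
      simp
    by_cases hkj : k = j
    · subst hkj
      rw [mul_comm e (c k), hj, mul_smul_comm, hee, smul_mul_assoc, add_mul, hs.idem,
        hs.orth i k hij, h1, hs.form_idem hB hij]
      simp
    · rw [mul_comm e (c k), hs.idem_mul_of_mem hij hki hkj he, hee, smul_mul_assoc, add_mul,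
        hs.orth i k (Ne.symm hki), hs.orth j k (Ne.symm hkj), hs.form_idem hB (Ne.symm hki),
        hs.form_idem hB (Ne.symm hkj)]
      simp
  · simp only [LinearMap.sub_apply, LinearMap.add_apply, LinearMap.smul_apply, tensor_apply htr,
      hs.form_of_mem hB hx, zero_smul, add_zero, smul_zero, zero_add]
    by_cases hsame : x ∈ peirceSpace c i j
    · rw [hs.proj_apply_of_mem hij hsame, P_apply, hc.mul_eq_of_mem hB h1 hij he hsame, hee,
        smul_mul_assoc, mul_smul_comm, mul_comm e, add_mul_of_mem_peirceSpace he,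
        add_mul_of_mem_peirceSpace hsame]
      module
    have key : P e x = 0 ∧ (c i * x = 0 ∨ c j * x = 0) := by
      by_cases hki : k = i
      · subst hki
        have hlj : l ≠ j := by rintro rfl; exact hsame hx
        exact ⟨hc.P_apply_adjacent hB h1 hij hkl.symm hlj he hx,
          Or.inr (hs.idem_mul_of_mem hkl hij.symm hlj.symm hx)⟩
      by_cases hli : l = i
      · subst hli
        have hkj : k ≠ j := by rintro rfl; exact hsame (mem_peirceSpace_swap hx)
        exact ⟨hc.P_apply_adjacent hB h1 hij hki hkj he (mem_peirceSpace_swap hx),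
          Or.inr (hs.idem_mul_of_mem hkl hkj.symm hij.symm hx)⟩
      refine ⟨?_, Or.inl (hs.idem_mul_of_mem hkl (Ne.symm hki) (Ne.symm hli) hx)⟩
      by_cases hkj : k = j
      · subst hkj
        exact hc.P_apply_adjacent hB h1 hij.symm hkl.symm hli (mem_peirceSpace_swap he) hx
      by_cases hlj : l = j
      · subst hlj
        exact hc.P_apply_adjacent hB h1 hij.symm hkl hki (mem_peirceSpace_swap he)
          (mem_peirceSpace_swap hx)
      have h0 : (c i + c j) * x = 0 := by
        rw [add_mul, hs.idem_mul_of_mem hkl (Ne.symm hki) (Ne.symm hli) hx,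
          hs.idem_mul_of_mem hkl (Ne.symm hkj) (Ne.symm hlj) hx, add_zero]
      rw [P_apply, hee, smul_mul_assoc, h0, hs.mul_eq_zero_of_mem hij he h0]
      simp
    obtain ⟨hP, h0⟩ := key
    have hpr : IsSystem.proj c i j x = 0 := by
      rw [hs.proj_apply_of_ne hij]
      rcases h0 with h0 | h0
      · rw [hs.idem_mul_idem_comm, h0, mul_zero, smul_zero]
      · rw [h0, mul_zero, smul_zero]
    have hex : B e x = 0 := by
      rcases h0 with h0 | h0
      · exact hB.eq_zero_of_half_zero hi h0
      · exact hB.eq_zero_of_half_zero hj h0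
    rw [hP, hpr, hex]
    simp

theorem proj_self_eq (hB : IsInvariantForm B) (htr : ∀ x y, tr V (x * y) = B x y)
    (hc : IsJordanFrame c) (h1 : ∀ i, B (c i) (c i) = 1) (i : Fin m) :
    IsSystem.proj c i i = tensor (c i) (c i) := by
  have hs := hc.isSystem
  ext x
  obtain ⟨a, ha⟩ := hc.proj_self_apply hB i x
  have h := hs.proj_symm hB i i (c i) x
  have h2 : IsSystem.proj c i i (c i) = c i := by
    rw [IsSystem.proj_apply, hs.idem, hs.idem]; module
  rw [h2, ha, map_smul, h1, smul_eq_mul, mul_one] at h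
  rw [ha, tensor_apply htr, h]

/-- `2 P(c_i, c_j)` is the orthogonal projection onto `V_ij`. In tensor form it can be fed to
`casimir`. -/
theorem proj_eq_sum_tensor (hB : IsInvariantForm B) (htr : ∀ x y, tr V (x * y) = B x y)
    (hc : IsJordanFrame c) {i j : Fin m} (hij : i ≠ j) :
    ∃ e : Fin (Module.finrank ℝ (peirceSpace c i j)) → V,
      (∀ k, e k ∈ peirceSpace c i j) ∧ (∀ k, B (e k) (e k) = 1) ∧
      (2 : ℝ) • IsSystem.proj c i j = ∑ k, tensor (e k) (e k) := by
  have hs := hc.isSystem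
  obtain ⟨e, he, hon, hexp⟩ := exists_orthonormal_family B hB.symm hB.pos (peirceSpace c i j)
  refine ⟨e, he, fun k => by rw [hon, if_pos rfl], ?_⟩
  ext x
  rw [LinearMap.smul_apply, hexp _ (hs.proj_mem hij x), LinearMap.sum_apply, Finset.smul_sum]
  refine Finset.sum_congr rfl fun k _ => ?_
  rw [← hs.proj_symm hB, hs.proj_apply_of_mem hij (he k), tensor_apply htr, map_smul,
    LinearMap.smul_apply, smul_smul, smul_eq_mul]
  congr 1
  ring

theorem trace_proj (hB : IsInvariantForm B) (htr : ∀ x y, tr V (x * y) = B x y)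
    (hc : IsJordanFrame c) (h1 : ∀ i, B (c i) (c i) = 1) {δ : ℝ}
    (hδ : ∀ i j, i ≠ j → (Module.finrank ℝ (peirceSpace c i j) : ℝ) = 2 * δ) (i j : Fin m) :
    LinearMap.trace ℝ V (IsSystem.proj c i j) = δ + if j = i then 1 - δ else 0 := by
  split_ifs with h
  · subst h
    rw [hc.proj_self_eq hB htr h1, trace_tensor htr, h1]
    ring
  · obtain ⟨e, -, h2, h3⟩ := hc.proj_eq_sum_tensor hB htr (Ne.symm h)
    have h4 := congrArg (LinearMap.trace ℝ V) h3
    rw [map_smul, map_sum] at h4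
    simp only [trace_tensor htr, h2, Finset.sum_const, Finset.card_univ, Fintype.card_fin,
      nsmul_eq_mul, mul_one, smul_eq_mul, hδ i j (Ne.symm h)] at h4
    linarith

theorem trace_L_idem (hB : IsInvariantForm B) (htr : ∀ x y, tr V (x * y) = B x y)
    (hc : IsJordanFrame c) (h1 : ∀ i, B (c i) (c i) = 1) {δ : ℝ}
    (hδ : ∀ i j, i ≠ j → (Module.finrank ℝ (peirceSpace c i j) : ℝ) = 2 * δ) (i : Fin m) :
    LinearMap.trace ℝ V (L (c i)) = 1 + (m - 1) * δ := by
  rw [← hc.isSystem.sum_proj, map_sum]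
  simp only [hc.trace_proj hB htr h1 hδ, Finset.sum_add_distrib, Finset.sum_ite_eq',
    Finset.mem_univ, if_true, Finset.sum_const, Finset.card_univ, Fintype.card_fin, nsmul_eq_mul]
  ring

theorem finrank_eq (hB : IsInvariantForm B) (htr : ∀ x y, tr V (x * y) = B x y)
    (hc : IsJordanFrame c) (h1 : ∀ i, B (c i) (c i) = 1) {δ : ℝ}
    (hδ : ∀ i j, i ≠ j → (Module.finrank ℝ (peirceSpace c i j) : ℝ) = 2 * δ) :
    (Module.finrank ℝ V : ℝ) = m * (1 + (m - 1) * δ) := by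
  have : L (1 : V) = 1 := by ext; simp
  rw [← LinearMap.trace_one, ← this, ← hc.2.2]
  have hsum : L (∑ i, c i) = ∑ i, L (c i) := by ext x; simp [Finset.sum_mul]
  rw [hsum, map_sum]
  simp only [hc.trace_L_idem hB htr h1 hδ, Finset.sum_const, Finset.card_univ, Fintype.card_fin,
    nsmul_eq_mul]

end IsJordanFrame

end PeirceOperators

/-! ### Independence of the Peirce constant from the frame. -/

section PeirceConstant

variable {V : Type*} [NonAssocCommRing V] [Module ℝ V] [SMulCommClass ℝ V V]
  [IsScalarTower ℝ V V] [IsCommJordan V] [FiniteDimensional ℝ V]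
  {B : V →ₗ[ℝ] V →ₗ[ℝ] ℝ}

/-- All off-diagonal Peirce spaces of all Jordan frames have the same dimension. -/
theorem IsPeirceConstant.finrank_eq (hB : IsInvariantForm B)
    (htr : ∀ x y, tr V (x * y) = B x y) (hS : IsSimple V)
    (hframe : ∀ (m : ℕ) (c : Fin m → V), IsJordanFrame c → m = rank V ∧ ∀ i, B (c i) (c i) = 1)
    {d : ℕ} (hd : IsPeirceConstant V d) {c : Fin (rank V) → V} (hc : IsJordanFrame c)
    {i j : Fin (rank V)} (hij : i ≠ j) : Module.finrank ℝ (peirceSpace c i j) = d := by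
  have hr : 2 ≤ rank V := by
    have h1 := i.2
    have h2 := j.2
    have h3 : (i : ℕ) ≠ j := fun h => hij (Fin.ext h)
    omega
  obtain ⟨c₀, hc₀, k, l, hkl, hd₀⟩ := hd (by omega)
  -- Both frames satisfy `n = r (1 + (r-1) δ)`, which determines `δ` because `r ≥ 2`.
  have e1 := hc.finrank_eq hB htr (hframe _ c hc).2
    (δ := (Module.finrank ℝ (peirceSpace c i j) : ℝ) / 2)
    (fun p q hpq => by rw [hc.finrank_peirceSpace_const hB hS hpq hij]; ring)
  have e2 := hc₀.finrank_eq hB htr (hframe _ c₀ hc₀).2 (δ := (d : ℝ) / 2)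
    (fun p q hpq => by rw [hc₀.finrank_peirceSpace_const hB hS hpq hkl, hd₀]; ring)
  have hr' : (2 : ℝ) ≤ rank V := by exact_mod_cast hr
  rw [e1] at e2
  have e3 := mul_left_cancel₀ (by positivity) e2
  have e4 := mul_left_cancel₀ (by linarith : (rank V : ℝ) - 1 ≠ 0) (add_left_cancel e3)
  have e5 : (Module.finrank ℝ (peirceSpace c i j) : ℝ) = d := by linarith
  exact_mod_cast e5

end PeirceConstant

end EJA

namespace EJA

/-! ### The operator behind `Ψ` and its symmetry. -/

section Casimir

variable {V : Type*} [NonAssocCommRing V] [Module ℝ V] [SMulCommClass ℝ V V]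
  [IsScalarTower ℝ V V] [IsCommJordan V] [FiniteDimensional ℝ V] {B : V →ₗ[ℝ] V →ₗ[ℝ] ℝ}

variable (V) in
/-- The polarization of `P`. -/
noncomputable def polarP : V →ₗ[ℝ] V →ₗ[ℝ] Module.End ℝ V :=
  LinearMap.mk₂ ℝ (fun a b => L a * L b + L b * L a - L (a * b))
    (fun a b x => by
      ext z
      simp only [LinearMap.sub_apply, LinearMap.add_apply, Module.End.mul_apply, L_apply, add_mul,
        mul_add]
      abel)
    (fun r a x => by
      ext z
      simp only [LinearMap.sub_apply, LinearMap.add_apply, LinearMap.smul_apply,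
        Module.End.mul_apply, L_apply, smul_mul_assoc, mul_smul_comm, smul_add, smul_sub])
    (fun a x y => by
      ext z
      simp only [LinearMap.sub_apply, LinearMap.add_apply, Module.End.mul_apply, L_apply, add_mul,
        mul_add]
      abel)
    (fun r a x => by
      ext z
      simp only [LinearMap.sub_apply, LinearMap.add_apply, LinearMap.smul_apply,
        Module.End.mul_apply, L_apply, smul_mul_assoc, mul_smul_comm, smul_add, smul_sub])

theorem polarP_apply (a b x : V) :
    polarP V a b x = a * (b * x) + b * (a * x) - a * b * x := rfl

theorem polarP_self (a : V) : polarP V a a = P a := by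
  ext x
  rw [polarP_apply, P_apply]
  module

/-- The operator `f ↦ ∑ P(f b_k, b_k)`. -/
noncomputable def casimir {n : ℕ} (b : Fin n → V) : Module.End ℝ (Module.End ℝ V) :=
  ∑ k, (polarP V).flip (b k) ∘ₗ LinearMap.applyₗ (b k)

theorem casimir_apply {n : ℕ} (b : Fin n → V) (f : Module.End ℝ V) :
    casimir b f = ∑ k, polarP V (f (b k)) (b k) := by
  simp [casimir]

/-- The adjoint of an operator, in terms of an orthonormal basis. -/
noncomputable def adj (B : V →ₗ[ℝ] V →ₗ[ℝ] ℝ) {n : ℕ} (b : Fin n → V) :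
    Module.End ℝ (Module.End ℝ V) where
  toFun f := ∑ k, (B (f (b k))).smulRight (b k)
  map_add' f g := by ext x; simp [add_smul, Finset.sum_add_distrib]
  map_smul' r f := by ext x; simp [mul_smul, Finset.smul_sum]

theorem adj_apply (B : V →ₗ[ℝ] V →ₗ[ℝ] ℝ) {n : ℕ} (b : Fin n → V) (f : Module.End ℝ V) (x : V) :
    adj B b f x = ∑ k, B (f (b k)) x • b k := by
  simp [adj]

theorem mem_symOp_iff (htr : ∀ x y, tr V (x * y) = B x y) (f : Module.End ℝ V) :
    f ∈ symOp V ↔ ∀ x y, B (f x) y = B x (f y) := by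
  simp only [← htr]; rfl

theorem P_mem_symOp (hB : IsInvariantForm B) (htr : ∀ x y, tr V (x * y) = B x y) (y : V) :
    P y ∈ symOp V :=
  (mem_symOp_iff htr _).2 (hB.P_symm y)

theorem casimir_mem_symOp (hB : IsInvariantForm B) (htr : ∀ x y, tr V (x * y) = B x y) {n : ℕ}
    (b : Fin n → V) (f : Module.End ℝ V) : casimir b f ∈ symOp V := by
  rw [casimir_apply]
  refine Submodule.sum_mem _ fun k _ => (mem_symOp_iff htr _).2 fun x y => ?_
  simp only [polarP_apply, map_add, map_sub, LinearMap.add_apply, LinearMap.sub_apply, hB.inv]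
  ring

/-- Both sides equal `B (b x) (a y) + B (a x) (b y) - B (a b) (x y)`. The symmetry of `Ψ` rests on
this. -/
theorem IsInvariantForm.polarP_comm (hB : IsInvariantForm B) (a b x y : V) :
    B (polarP V a b x) y = B (polarP V x y a) b := by
  have key : ∀ a b x y, B (polarP V a b x) y =
      B (b * x) (a * y) + B (a * x) (b * y) - B (a * b) (x * y) := by
    intro a b x y
    rw [polarP_apply, mul_comm (a * b) x]
    simp only [map_add, map_sub, LinearMap.add_apply, LinearMap.sub_apply]
    rw [hB.inv a (b * x) y, hB.inv b (a * x) y, hB.inv x (a * b) y]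
  rw [key, key, mul_comm y a, mul_comm x b, mul_comm x a, mul_comm y b, hB.symm (a * y),
    hB.symm (x * y)]

end Casimir

end EJA

namespace EJA

/-! ### Values and trace of the Casimir operator; symmetric operators. -/

section OrthonormalBasis

/-- `b` is an orthonormal basis for `B`. -/
structure IsOrthonormalBasis {V : Type*} [AddCommGroup V] [Module ℝ V]
    (B : V →ₗ[ℝ] V →ₗ[ℝ] ℝ) {n : ℕ} (b : Fin n → V) : Prop where
  form : ∀ i j, B (b i) (b j) = if i = j then 1 else 0
  expand : ∀ x, x = ∑ i, B (b i) x • b i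

variable {V : Type*} [NonAssocCommRing V] [Module ℝ V] [SMulCommClass ℝ V V]
  [IsScalarTower ℝ V V] [IsCommJordan V] [FiniteDimensional ℝ V] {B : V →ₗ[ℝ] V →ₗ[ℝ] ℝ}
  {n : ℕ} {b : Fin n → V}

theorem IsInvariantForm.exists_orthonormalBasis (hB : IsInvariantForm B) :
    ∃ b : Fin (Module.finrank ℝ V) → V, IsOrthonormalBasis B b := by
  obtain ⟨b, -, h1, h2⟩ := exists_orthonormal_family B hB.symm hB.pos ⊤
  have e : Module.finrank ℝ V = Module.finrank ℝ (⊤ : Submodule ℝ V) := finrank_top ℝ V |>.symm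
  rw [e]
  exact ⟨b, h1, fun x => h2 x Submodule.mem_top⟩

namespace IsOrthonormalBasis

theorem trace_eq (hb : IsOrthonormalBasis B b) (f : Module.End ℝ V) :
    LinearMap.trace ℝ V f = ∑ k, B (b k) (f (b k)) :=
  trace_eq_sum_of_expansion (fun k => B (b k)) b hb.expand f

theorem end_expand (htr : ∀ x y, tr V (x * y) = B x y) (hb : IsOrthonormalBasis B b)
    (f : Module.End ℝ V) :
    f = ∑ p : Fin n × Fin n, B (b p.1) (f (b p.2)) • tensor (b p.1) (b p.2) := by
  ext x
  rw [Fintype.sum_prod_type, Finset.sum_comm]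
  simp only [LinearMap.sum_apply, LinearMap.smul_apply, tensor_apply htr]
  conv_lhs => rw [hb.expand x, map_sum]
  refine Finset.sum_congr rfl fun l _ => ?_
  rw [map_smul]
  conv_lhs => rw [hb.expand (f (b l)), Finset.smul_sum]
  exact Finset.sum_congr rfl fun k _ => smul_comm _ _ _

theorem trace_end (htr : ∀ x y, tr V (x * y) = B x y) (hb : IsOrthonormalBasis B b)
    (Φ : Module.End ℝ (Module.End ℝ V)) :
    LinearMap.trace ℝ _ Φ = ∑ k, ∑ l, B (b k) (Φ (tensor (b k) (b l)) (b l)) := by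
  have := trace_eq_sum_of_expansion
    (fun p : Fin n × Fin n => B (b p.1) ∘ₗ LinearMap.applyₗ (b p.2))
    (fun p => tensor (b p.1) (b p.2)) (fun f => hb.end_expand htr f) Φ
  rw [this, Fintype.sum_prod_type]
  rfl

/-- Expanding `y` in the basis `b` reproduces the defining sum; in particular `casimir b` does not
depend on `b`. -/
theorem casimir_tensor (hB : IsInvariantForm B) (htr : ∀ x y, tr V (x * y) = B x y)
    (hb : IsOrthonormalBasis B b) (x y : V) : casimir b (tensor x y) = polarP V x y := by
  conv_rhs => rw [hb.expand y, map_sum]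
  rw [casimir_apply]
  refine Finset.sum_congr rfl fun k _ => ?_
  rw [tensor_apply htr, map_smul, map_smul, LinearMap.smul_apply, hB.symm]

theorem adj_tensor (hB : IsInvariantForm B) (htr : ∀ x y, tr V (x * y) = B x y)
    (hb : IsOrthonormalBasis B b) (x y : V) : adj B b (tensor x y) = tensor y x := by
  ext z
  rw [adj_apply, tensor_apply htr]
  conv_rhs => rw [hb.expand y, Finset.smul_sum]
  refine Finset.sum_congr rfl fun k _ => ?_
  rw [tensor_apply htr, map_smul, LinearMap.smul_apply, smul_smul, smul_eq_mul, hB.symm y,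
    mul_comm]

theorem adj_form (hB : IsInvariantForm B) (hb : IsOrthonormalBasis B b) (f : Module.End ℝ V)
    (x y : V) : B (adj B b f x) y = B x (f y) := by
  rw [adj_apply, hB.symm x]
  conv_rhs => rw [hb.expand y]
  simp only [map_sum, map_smul, LinearMap.sum_apply, LinearMap.smul_apply, smul_eq_mul]
  exact Finset.sum_congr rfl fun k _ => mul_comm _ _

theorem adj_eq_self (htr : ∀ x y, tr V (x * y) = B x y)
    (hb : IsOrthonormalBasis B b) {f : Module.End ℝ V} (hf : f ∈ symOp V) : adj B b f = f := by
  ext x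
  rw [adj_apply]
  conv_rhs => rw [hb.expand (f x)]
  exact Finset.sum_congr rfl fun k _ => by rw [(mem_symOp_iff htr f).1 hf]

theorem symmetrize_mem (hB : IsInvariantForm B) (htr : ∀ x y, tr V (x * y) = B x y)
    (hb : IsOrthonormalBasis B b) (f : Module.End ℝ V) :
    ((1 / 2 : ℝ) • (1 + adj B b)) f ∈ symOp V := by
  rw [mem_symOp_iff htr]
  intro x y
  have h1 := hb.adj_form hB f x y
  have h2 := hb.adj_form hB f y x
  simp only [LinearMap.smul_apply, LinearMap.add_apply, Module.End.one_apply, map_smul, map_add,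
    h1, smul_eq_mul]
  rw [hB.symm x (adj B b f y), h2, hB.symm y]
  ring

variable (B b) in
/-- The projection of operators onto symmetric operators. -/
noncomputable def symmetrize (h : ∀ f, ((1 / 2 : ℝ) • (1 + adj B b)) f ∈ symOp V) :
    Module.End ℝ V →ₗ[ℝ] symOp V :=
  ((1 / 2 : ℝ) • (1 + adj B b)).codRestrict (symOp V) h

theorem symmetrize_apply_coe (hB : IsInvariantForm B) (htr : ∀ x y, tr V (x * y) = B x y)
    (hb : IsOrthonormalBasis B b) (f : symOp V) :
    symmetrize B b (hb.symmetrize_mem hB htr) f = f := by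
  refine Subtype.ext ?_
  change ((1 / 2 : ℝ) • (1 + adj B b)) (f : Module.End ℝ V) = f
  simp only [LinearMap.smul_apply, LinearMap.add_apply, Module.End.one_apply,
    hb.adj_eq_self htr f.2]
  module

/-- Symmetrization retracts `End V` onto `F`, so the dimension is its trace `(n² + Tr adj) / 2`, and
`Tr adj = n`. -/
theorem finrank_symOp (hB : IsInvariantForm B) (htr : ∀ x y, tr V (x * y) = B x y)
    (hb : IsOrthonormalBasis B b) (hn : Module.finrank ℝ V = n) :
    (Module.finrank ℝ (symOp V) : ℝ) = n * (n + 1) / 2 := by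
  have h1 : symmetrize B b (hb.symmetrize_mem hB htr) ∘ₗ (symOp V).subtype = LinearMap.id := by
    ext1 f
    exact hb.symmetrize_apply_coe hB htr f
  have h2 : (symOp V).subtype ∘ₗ symmetrize B b (hb.symmetrize_mem hB htr) =
      (1 / 2 : ℝ) • (1 + adj B b) := LinearMap.subtype_comp_codRestrict _ _ _
  have h3 := LinearMap.trace_comp_comm' (symOp V).subtype
    (symmetrize B b (hb.symmetrize_mem hB htr))
  rw [h2, h1, LinearMap.trace_id] at h3
  rw [h3, map_smul, map_add, LinearMap.trace_one, Module.finrank_linearMap, hn,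
    hb.trace_end htr]
  have h4 : ∀ k l, B (b k) (adj B b (tensor (b k) (b l)) (b l)) = if k = l then 1 else 0 := by
    intro k l
    rw [hb.adj_tensor hB htr, tensor_apply htr, map_smul, hb.form]
    split_ifs <;> simp
  simp only [h4, Finset.sum_ite_eq, Finset.mem_univ, if_true, Finset.sum_const,
    Finset.card_univ, Fintype.card_fin, nsmul_eq_mul, smul_eq_mul]
  push_cast
  ring

theorem span_tensor_eq_top (hB : IsInvariantForm B) (htr : ∀ x y, tr V (x * y) = B x y)
    (hb : IsOrthonormalBasis B b) :
    Submodule.span ℝ (Set.range fun y : V => (⟨tensor y y, tensor_self_mem y⟩ : symOp V)) = ⊤ := by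
  rw [eq_top_iff]
  intro f _
  rw [← hb.symmetrize_apply_coe hB htr f, hb.end_expand htr (f : Module.End ℝ V), map_sum]
  refine Submodule.sum_mem _ fun p _ => ?_
  rw [map_smul]
  refine Submodule.smul_mem _ _ ?_
  have h : symmetrize B b (hb.symmetrize_mem hB htr) (tensor (b p.1) (b p.2)) =
      (1 / 2 : ℝ) • ((⟨tensor (b p.1 + b p.2) (b p.1 + b p.2), tensor_self_mem _⟩ : symOp V) -
        ⟨tensor (b p.1) (b p.1), tensor_self_mem _⟩ -
        ⟨tensor (b p.2) (b p.2), tensor_self_mem _⟩) := by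
    refine Subtype.ext ?_
    change ((1 / 2 : ℝ) • (1 + adj B b)) (tensor (b p.1) (b p.2)) = (1 / 2 : ℝ) •
      (tensor (b p.1 + b p.2) (b p.1 + b p.2) - tensor (b p.1) (b p.1) - tensor (b p.2) (b p.2))
    ext x
    simp only [LinearMap.smul_apply, LinearMap.add_apply, Module.End.one_apply,
      hb.adj_tensor hB htr, LinearMap.sub_apply, tensor_apply htr, map_add]
    module
  rw [h]
  exact Submodule.smul_mem _ _ (Submodule.sub_mem _ (Submodule.sub_mem _
    (Submodule.subset_span ⟨_, rfl⟩) (Submodule.subset_span ⟨_, rfl⟩))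
    (Submodule.subset_span ⟨_, rfl⟩))

theorem trace_casimir_mul (hB : IsInvariantForm B) (hb : IsOrthonormalBasis B b)
    (f g : Module.End ℝ V) :
    LinearMap.trace ℝ V (casimir b f * g) = LinearMap.trace ℝ V (f * casimir b g) := by
  rw [LinearMap.trace_mul_comm ℝ f, hb.trace_eq, hb.trace_eq]
  simp only [Module.End.mul_apply, casimir_apply, LinearMap.sum_apply, map_sum]
  rw [Finset.sum_comm]
  refine Finset.sum_congr rfl fun k _ => Finset.sum_congr rfl fun l _ => ?_
  rw [hB.symm (b l), hB.polarP_comm, hB.symm]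

/-- For `i ≠ j` this is half the sum of `P e` over an orthonormal basis of `V_ij`: in `P_of_mem` the
terms `e ⊗ e` add up to `2 P(c_i, c_j)`, the others are multiplied by `2δ`. -/
theorem casimir_proj (hB : IsInvariantForm B) (htr : ∀ x y, tr V (x * y) = B x y)
    (hb : IsOrthonormalBasis B b) {m : ℕ} {c : Fin m → V} (hc : IsJordanFrame c)
    (h1 : ∀ i, B (c i) (c i) = 1) {δ : ℝ}
    (hδ : ∀ i j, i ≠ j → (Module.finrank ℝ (peirceSpace c i j) : ℝ) = 2 * δ) (i j : Fin m) :
    casimir b (IsSystem.proj c i j) =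
      (δ / 2) • (tensor (c i) (c j) + tensor (c j) (c i)) + (1 - δ) • IsSystem.proj c i j := by
  by_cases hij : i = j
  · subst hij
    have h2 : P (c i) = tensor (c i) (c i) := by
      rw [← hc.proj_self_eq hB htr h1]; rfl
    rw [hc.proj_self_eq hB htr h1, hb.casimir_tensor hB htr, polarP_self, h2]
    module
  · obtain ⟨e, h2, h3, h4⟩ := hc.proj_eq_sum_tensor hB htr hij
    have h5 := congrArg (casimir b) h4
    rw [map_smul, map_sum] at h5
    simp only [hb.casimir_tensor hB htr, polarP_self, hc.P_of_mem hB htr h1 hij (h2 _), h3,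
      Finset.sum_sub_distrib, Finset.sum_add_distrib, Finset.sum_const, Finset.card_univ,
      Fintype.card_fin] at h5
    rw [← h4, ← Nat.cast_smul_eq_nsmul ℝ, ← Nat.cast_smul_eq_nsmul ℝ,
      hδ i j hij] at h5
    linear_combination (norm := module) (1 / 2 : ℝ) • h5

theorem casimir_P (hB : IsInvariantForm B) (htr : ∀ x y, tr V (x * y) = B x y)
    (hb : IsOrthonormalBasis B b) {m : ℕ} {c : Fin m → V} (hc : IsJordanFrame c)
    (h1 : ∀ i, B (c i) (c i) = 1) {δ : ℝ}
    (hδ : ∀ i j, i ≠ j → (Module.finrank ℝ (peirceSpace c i j) : ℝ) = 2 * δ) (a : Fin m → ℝ) :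
    casimir b (P (∑ i, a i • c i)) =
      δ • tensor (∑ i, a i • c i) (∑ i, a i • c i) + (1 - δ) • P (∑ i, a i • c i) := by
  have h2 : ∑ i, ∑ j, (a i * a j) • tensor (c i) (c j) =
      tensor (∑ i, a i • c i) (∑ i, a i • c i) := by
    ext x
    simp only [LinearMap.sum_apply, LinearMap.smul_apply, tensor_apply htr, map_sum, map_smul,
      Finset.sum_smul, Finset.smul_sum]
    refine Finset.sum_congr rfl fun i _ => Finset.sum_congr rfl fun j _ => ?_
    rw [smul_eq_mul]
    module
  have h3 : ∑ i, ∑ j, (a i * a j) • tensor (c j) (c i) =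
      tensor (∑ i, a i • c i) (∑ i, a i • c i) := by
    rw [← h2, Finset.sum_comm]
    exact Finset.sum_congr rfl fun i _ => Finset.sum_congr rfl fun j _ => by rw [mul_comm]
  rw [hc.isSystem.P_sum]
  simp only [map_sum, map_smul, hb.casimir_proj hB htr hc h1 hδ]
  have h4 : ∀ i j, (a i * a j) • ((δ / 2) • (tensor (c i) (c j) + tensor (c j) (c i)) +
      (1 - δ) • IsSystem.proj c i j) = (δ / 2) • ((a i * a j) • tensor (c i) (c j)) +
      (δ / 2) • ((a i * a j) • tensor (c j) (c i)) +
      (1 - δ) • ((a i * a j) • IsSystem.proj c i j) := fun i j => by module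
  simp only [h4, Finset.sum_add_distrib, ← Finset.smul_sum, h2, h3]
  module

/-- In `B b_k (P(b_k, b_l) b_l)` two of the three terms cancel, leaving `B (b_k²) (b_l²)`. The
element `∑ b_k²` represents `x ↦ Tr L(x)`, so it pairs like `τ • 1`. -/
theorem trace_casimir (hB : IsInvariantForm B) (htr : ∀ x y, tr V (x * y) = B x y)
    (hb : IsOrthonormalBasis B b) {τ : ℝ} (hτ : ∀ x, LinearMap.trace ℝ V (L x) = τ * B 1 x) :
    LinearMap.trace ℝ _ (casimir b) = τ * τ * B 1 1 := by
  have h1 : ∀ x, B (∑ k, b k * b k) x = τ * B 1 x := by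
    intro x
    rw [← hτ, hb.trace_eq, map_sum, LinearMap.sum_apply]
    refine Finset.sum_congr rfl fun k _ => ?_
    rw [hB.inv, L_apply, mul_comm x]
  rw [hb.trace_end htr]
  have h2 : ∀ k l, B (b k) (casimir b (tensor (b k) (b l)) (b l)) = B (b k * b k) (b l * b l) := by
    intro k l
    rw [hb.casimir_tensor hB htr, polarP_apply, mul_comm (b k * b l) (b l)]
    simp only [map_add, map_sub]
    rw [add_sub_cancel_right, hB.inv]
  simp only [h2]
  simp only [← map_sum]
  rw [← LinearMap.sum_apply, ← map_sum, h1, hB.symm, h1]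
  ring

end IsOrthonormalBasis

theorem trace_L (hB : IsInvariantForm B) {m : ℕ} {τ : ℝ}
    (hframe : ∀ (k : ℕ) (c : Fin k → V), IsJordanFrame c → k = m ∧ ∀ i, B (c i) (c i) = 1)
    (hτ : ∀ c : Fin m → V, IsJordanFrame c → ∀ i, LinearMap.trace ℝ V (L (c i)) = τ) (x : V) :
    LinearMap.trace ℝ V (L x) = τ * B 1 x := by
  obtain ⟨k, c, a, -, hc, rfl⟩ := exists_frame_of hB x
  obtain ⟨rfl, h1⟩ := hframe k c hc
  have h2 : L (∑ i, a i • c i) = ∑ i, a i • L (c i) := by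
    ext y
    simp [Finset.sum_mul, smul_mul_assoc]
  rw [hB.symm, hc.form_one_sum hB h1, h2, map_sum, one_mul, Finset.mul_sum]
  refine Finset.sum_congr rfl fun i _ => ?_
  rw [map_smul, hτ c hc, smul_eq_mul, mul_comm]

end OrthonormalBasis

/-! ### Abstract operators with eigenvalues `1` and `-δ`. -/

section TwoEigenvalues

variable {F : Type*} [AddCommGroup F] [Module ℝ F] [FiniteDimensional ℝ F] {ι : Type*}
  {T Q : ι → F} {Ψ : Module.End ℝ F} {δ : ℝ}

theorem span_le_eigenspace_one (hT : ∀ y, Ψ (T y) = Q y)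
    (hQ : ∀ y, Ψ (Q y) = δ • T y + (1 - δ) • Q y) :
    Submodule.span ℝ (Set.range fun y => δ • T y + Q y) ≤ Module.End.eigenspace Ψ 1 := by
  rw [Submodule.span_le]
  rintro _ ⟨y, rfl⟩
  rw [SetLike.mem_coe, Module.End.mem_eigenspace_iff, map_add, map_smul, hT, hQ]
  module

theorem span_le_eigenspace_neg (hT : ∀ y, Ψ (T y) = Q y)
    (hQ : ∀ y, Ψ (Q y) = δ • T y + (1 - δ) • Q y) :
    Submodule.span ℝ (Set.range fun y => T y - Q y) ≤ Module.End.eigenspace Ψ (-δ) := by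
  rw [Submodule.span_le]
  rintro _ ⟨y, rfl⟩
  rw [SetLike.mem_coe, Module.End.mem_eigenspace_iff, map_sub, hT, hQ]
  module

/-- The eigenvalues `1` and `-δ` differ, and `(1 + δ) T = (δ T + Q) + (T - Q)`. -/
theorem isCompl_span (hδ : 0 ≤ δ) (hspan : Submodule.span ℝ (Set.range T) = ⊤)
    (hT : ∀ y, Ψ (T y) = Q y) (hQ : ∀ y, Ψ (Q y) = δ • T y + (1 - δ) • Q y) :
    IsCompl (Submodule.span ℝ (Set.range fun y => δ • T y + Q y))
      (Submodule.span ℝ (Set.range fun y => T y - Q y)) := by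
  refine ⟨?_, ?_⟩
  · exact (Module.End.disjoint_genEigenspace Ψ (by linarith : (1 : ℝ) ≠ -δ) 1 1).mono
      (span_le_eigenspace_one hT hQ) (span_le_eigenspace_neg hT hQ)
  · rw [codisjoint_iff, eq_top_iff, ← hspan, Submodule.span_le]
    rintro _ ⟨y, rfl⟩
    have h0 : 1 + δ ≠ 0 := by positivity
    have h : T y = (1 + δ)⁻¹ • (δ • T y + Q y) + (1 + δ)⁻¹ • (T y - Q y) := by
      match_scalars
      · field_simp
        ring
      · ring
    rw [SetLike.mem_coe, h]
    exact Submodule.add_mem_sup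
      (Submodule.smul_mem _ _ (Submodule.subset_span ⟨y, rfl⟩))
      (Submodule.smul_mem _ _ (Submodule.subset_span ⟨y, rfl⟩))

variable {F₁ F₂ : Submodule ℝ F}

theorem eigenspace_eq_of_isCompl {μ ν : ℝ} (hne : μ ≠ ν) (hc : IsCompl F₁ F₂)
    (h1 : F₁ ≤ Module.End.eigenspace Ψ μ) (h2 : F₂ ≤ Module.End.eigenspace Ψ ν) :
    Module.End.eigenspace Ψ μ = F₁ := by
  refine le_antisymm (fun x hx => ?_) h1
  have hx' : x ∈ F₁ ⊔ F₂ := hc.sup_eq_top ▸ Submodule.mem_top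
  obtain ⟨a, ha, b, hb, rfl⟩ := Submodule.mem_sup.1 hx'
  have hb' : b ∈ Module.End.eigenspace Ψ μ := by
    have := Submodule.sub_mem _ hx (h1 ha)
    rwa [add_sub_cancel_left] at this
  have h0 : b = 0 := by
    have := (Module.End.disjoint_genEigenspace Ψ hne 1 1).le_bot ⟨hb', h2 hb⟩
    simpa using this
  rw [h0, add_zero]
  exact ha

theorem eigenvalue_of_isCompl {μ ν ρ : ℝ} (hc : IsCompl F₁ F₂)
    (h1 : F₁ ≤ Module.End.eigenspace Ψ μ) (h2 : F₂ ≤ Module.End.eigenspace Ψ ν)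
    (hρ : Module.End.HasEigenvalue Ψ ρ) : ρ = μ ∨ ρ = ν := by
  by_contra! hne
  obtain ⟨x, hx, hx0⟩ := hρ.exists_hasEigenvector
  have hx' : x ∈ F₁ ⊔ F₂ := hc.sup_eq_top ▸ Submodule.mem_top
  obtain ⟨a, ha, b, hb, rfl⟩ := Submodule.mem_sup.1 hx'
  have e1 := Module.End.mem_eigenspace_iff.1 hx
  rw [map_add, Module.End.mem_eigenspace_iff.1 (h1 ha), Module.End.mem_eigenspace_iff.1 (h2 hb)]
    at e1
  have e2 : (μ - ρ) • a = (ρ - ν) • b := by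
    linear_combination (norm := module) e1
  have e3 : (μ - ρ) • a = 0 := by
    have := hc.disjoint.le_bot
      ⟨Submodule.smul_mem F₁ (μ - ρ) ha, e2 ▸ Submodule.smul_mem F₂ (ρ - ν) hb⟩
    simpa using this
  have e4 := e3
  rw [e2] at e4
  have ha0 := (smul_eq_zero.1 e3).resolve_left (sub_ne_zero.2 hne.1.symm)
  have hb0 := (smul_eq_zero.1 e4).resolve_left (sub_ne_zero.2 hne.2)
  exact hx0 (by rw [ha0, hb0, add_zero])

/-- `(1 + δ)⁻¹ (Ψ + δ)` is the projection onto `F₁` along `F₂`, so its trace is `dim F₁`. -/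
theorem trace_of_isCompl (hδ : 0 ≤ δ) (hc : IsCompl F₁ F₂)
    (h1 : F₁ ≤ Module.End.eigenspace Ψ 1) (h2 : F₂ ≤ Module.End.eigenspace Ψ (-δ)) :
    LinearMap.trace ℝ F Ψ = Module.finrank ℝ F₁ - δ * Module.finrank ℝ F₂ := by
  have h0 : 1 + δ ≠ 0 := by positivity
  have hp : LinearMap.IsProj F₁ ((1 + δ)⁻¹ • (Ψ + δ • (1 : Module.End ℝ F))) := by
    refine ⟨fun x => ?_, fun x hx => ?_⟩
    · have hx' : x ∈ F₁ ⊔ F₂ := hc.sup_eq_top ▸ Submodule.mem_top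
      obtain ⟨a, ha, b, hb, rfl⟩ := Submodule.mem_sup.1 hx'
      have : ((1 + δ)⁻¹ • (Ψ + δ • (1 : Module.End ℝ F))) (a + b) = a := by
        simp only [LinearMap.smul_apply, LinearMap.add_apply, Module.End.one_apply, map_add,
          Module.End.mem_eigenspace_iff.1 (h1 ha), Module.End.mem_eigenspace_iff.1 (h2 hb)]
        match_scalars
        · field_simp
        · ring
      rw [this]
      exact ha
    · simp only [LinearMap.smul_apply, LinearMap.add_apply, Module.End.one_apply,
        Module.End.mem_eigenspace_iff.1 (h1 hx)]
      match_scalars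
      field_simp
  have h3 := hp.trace
  have h4 : (Module.finrank ℝ F₁ : ℝ) + Module.finrank ℝ F₂ = Module.finrank ℝ F := by
    exact_mod_cast Submodule.finrank_add_eq_of_isCompl hc
  rw [map_smul, map_add, map_smul, LinearMap.trace_one, ← h4, smul_eq_mul, smul_eq_mul,
    inv_mul_eq_iff_eq_mul₀ h0] at h3
  linarith

end TwoEigenvalues

end EJA

namespace EJA

theorem F₁_eq_span {V : Type*} [NonAssocCommRing V] [Module ℝ V] [SMulCommClass ℝ V V]
    [IsScalarTower ℝ V V] (δ : ℝ) (hP : ∀ y : V, P y ∈ symOp V) :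
    F₁ V δ = Submodule.span ℝ (Set.range fun y : V =>
      δ • (⟨tensor y y, tensor_self_mem y⟩ : symOp V) + ⟨P y, hP y⟩) := by
  rw [F₁]
  congr 1
  ext f
  exact exists_congr fun y => ⟨fun h => Subtype.ext h.symm, fun h => h ▸ rfl⟩

theorem F₂_eq_span {V : Type*} [NonAssocCommRing V] [Module ℝ V] [SMulCommClass ℝ V V]
    [IsScalarTower ℝ V V] (hP : ∀ y : V, P y ∈ symOp V) :
    F₂ V = Submodule.span ℝ (Set.range fun y : V =>
      (⟨tensor y y, tensor_self_mem y⟩ : symOp V) - ⟨P y, hP y⟩) := by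
  rw [F₂]
  congr 1
  ext f
  exact exists_congr fun y => ⟨fun h => Subtype.ext h.symm, fun h => h ▸ rfl⟩

end EJA

/-! ### The main theorem. -/

open EJA in
theorem theorem5p2 (V : Type*) [NonAssocCommRing V] [Module ℝ V] [SMulCommClass ℝ V V]
    [IsScalarTower ℝ V V] [FiniteDimensional ℝ V] [IsCommJordan V]
    (hE : EJA.IsEuclidean V) (hS : EJA.IsSimple V)
    (r : ℕ) (hr : r = EJA.rank V) (n : ℕ) (hn : n = Module.finrank ℝ V)
    (d : ℕ) (hd : EJA.IsPeirceConstant V d) (d' : ℝ) (hd' : (d : ℝ) = 2 * d') :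
    ∃ Ψ : Module.End ℝ (EJA.symOp V),
      -- `Ψ` is symmetric for the scalar product `Tr(f g)` on `F`
      (∀ f g : EJA.symOp V,
        LinearMap.trace ℝ V ((Ψ f : Module.End ℝ V) * (g : Module.End ℝ V)) =
          LinearMap.trace ℝ V ((f : Module.End ℝ V) * (Ψ g : Module.End ℝ V))) ∧
      (∀ y : V, (Ψ ⟨EJA.tensor y y, EJA.tensor_self_mem y⟩ : Module.End ℝ V) = EJA.P y) ∧
      (∀ y : V, ∃ hy : EJA.P y ∈ EJA.symOp V,
        (Ψ ⟨EJA.P y, hy⟩ : Module.End ℝ V) =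
          d' • EJA.tensor y y + (1 - d') • EJA.P y) ∧
      -- `F` is the orthogonal direct sum of `F₁` and `F₂`
      (∀ f ∈ EJA.F₁ V d', ∀ g ∈ EJA.F₂ V,
        LinearMap.trace ℝ V ((f : Module.End ℝ V) * (g : Module.End ℝ V)) = 0) ∧
      IsCompl (EJA.F₁ V d') (EJA.F₂ V) ∧
      -- `F₁` and `F₂` are the eigenspaces of `Ψ`, for the eigenvalues `1` and `-d'`
      Module.End.eigenspace Ψ 1 = EJA.F₁ V d' ∧
      Module.End.eigenspace Ψ (-d') = EJA.F₂ V ∧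
      Module.End.HasEigenvalue Ψ 1 ∧
      (2 ≤ r → Module.End.HasEigenvalue Ψ (-d')) ∧
      (∀ μ : ℝ, Module.End.HasEigenvalue Ψ μ → μ = 1 ∨ μ = -d') ∧
      -- the dimensions
      (n : ℝ) * (n + 1) / 2 - Module.finrank ℝ (EJA.F₁ V d') =
        Module.finrank ℝ (EJA.F₂ V) ∧
      (Module.finrank ℝ (EJA.F₂ V) : ℝ) =
        (r : ℝ) * (r - 1) / 2 *
          ((1 + d' * (2 * r - 3) + d' ^ 2 * (r - 1) * (r - 2)) / (1 + d')) := by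
  have hδ0 : 0 ≤ d' := by
    have : (0 : ℝ) ≤ d := Nat.cast_nonneg d
    linarith
  have hnt : Nontrivial V := hS.1
  obtain ⟨B, hB, htr, hframe⟩ := exists_trace_form hE hS
  obtain ⟨c, hc⟩ := exists_frame_rank hB
  have h1 := (hframe _ c hc).2
  have hdim : ∀ c : Fin (rank V) → V, IsJordanFrame c → ∀ i j, i ≠ j →
      (Module.finrank ℝ (peirceSpace c i j) : ℝ) = 2 * d' := fun c hc i j hij => by
    rw [hd.finrank_eq hB htr hS hframe hc hij, hd']
  have hτ : ∀ x, LinearMap.trace ℝ V (L x) = (1 + ((rank V : ℕ) - 1) * d') * B 1 x :=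
    trace_L hB hframe fun c hc i =>
      hc.trace_L_idem hB htr (hframe _ c hc).2 (hdim c hc) i
  have hnr : (n : ℝ) = r * (1 + (r - 1) * d') := by
    rw [hn, hr, hc.finrank_eq hB htr h1 (hdim c hc)]
  have hB1 : B 1 1 = r := by
    have := hc.form_one_sum hB h1 1
    simp only [Pi.one_apply, one_smul, hc.2.2, Finset.sum_const, Finset.card_univ,
      Fintype.card_fin, nsmul_eq_mul, mul_one, one_mul] at this
    rw [this, hr]
  obtain ⟨b, hb⟩ := hB.exists_orthonormalBasis
  have hP : ∀ y : V, P y ∈ symOp V := P_mem_symOp hB htr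
  let Ψ' : Module.End ℝ V →ₗ[ℝ] symOp V :=
    (casimir b).codRestrict (symOp V) (casimir_mem_symOp hB htr b)
  let Ψ : Module.End ℝ (symOp V) := Ψ' ∘ₗ (symOp V).subtype
  have hsymm : ∀ f g : symOp V,
      LinearMap.trace ℝ V ((Ψ f : Module.End ℝ V) * (g : Module.End ℝ V)) =
        LinearMap.trace ℝ V ((f : Module.End ℝ V) * (Ψ g : Module.End ℝ V)) := fun f g =>
    hb.trace_casimir_mul hB f g
  have hΨT : ∀ y : V, Ψ ⟨tensor y y, tensor_self_mem y⟩ = ⟨P y, hP y⟩ := fun y =>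
    Subtype.ext ((hb.casimir_tensor hB htr y y).trans (polarP_self y))
  have hΨP : ∀ y : V, Ψ ⟨P y, hP y⟩ =
      d' • (⟨tensor y y, tensor_self_mem y⟩ : symOp V) + (1 - d') • ⟨P y, hP y⟩ := by
    intro y
    obtain ⟨k, c, a, -, hc, rfl⟩ := exists_frame_of hB y
    obtain ⟨rfl, h1⟩ := hframe k c hc
    exact Subtype.ext (hb.casimir_P hB htr hc h1 (hdim c hc) a)
  have hspan := hb.span_tensor_eq_top hB htr
  have hF1 := F₁_eq_span d' hP
  have hF2 := F₂_eq_span hP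
  have hcompl : IsCompl (F₁ V d') (F₂ V) := by
    rw [hF1, hF2]
    exact isCompl_span hδ0 hspan hΨT hΨP
  have hle1 : F₁ V d' ≤ Module.End.eigenspace Ψ 1 := by
    rw [hF1]; exact span_le_eigenspace_one hΨT hΨP
  have hle2 : F₂ V ≤ Module.End.eigenspace Ψ (-d') := by
    rw [hF2]; exact span_le_eigenspace_neg hΨT hΨP
  have hne : (1 : ℝ) ≠ -d' := by linarith
  have heig1 := eigenspace_eq_of_isCompl hne hcompl hle1 hle2
  have heig2 := eigenspace_eq_of_isCompl hne.symm hcompl.symm hle2 hle1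
  have htrace : LinearMap.trace ℝ (symOp V) Ψ = (1 + (r - 1) * d') * n := by
    -- `casimir b` maps all of `End V` into `F`, so its trace on `End V` equals the trace of `Ψ` on
    -- `F`.
    have e1 : (symOp V).subtype ∘ₗ Ψ' = casimir b := LinearMap.subtype_comp_codRestrict _ _ _
    have e2 := LinearMap.trace_comp_comm' (symOp V).subtype Ψ'
    rw [e1, hb.trace_casimir hB htr hτ, hB1, ← hr] at e2
    rw [hnr]
    refine e2.trans ?_
    ring
  have htrace' := trace_of_isCompl hδ0 hcompl hle1 hle2
  rw [htrace] at htrace'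
  have hdimF : (Module.finrank ℝ (F₁ V d') : ℝ) + Module.finrank ℝ (F₂ V) = n * (n + 1) / 2 := by
    have e1 := hb.finrank_symOp hB htr rfl
    rw [← hn] at e1
    rw [← e1]
    exact_mod_cast Submodule.finrank_add_eq_of_isCompl hcompl
  have hdimF2 : (Module.finrank ℝ (F₂ V) : ℝ) = (r : ℝ) * (r - 1) / 2 *
      ((1 + d' * (2 * r - 3) + d' ^ 2 * (r - 1) * (r - 2)) / (1 + d')) := by
    have h0 : 1 + d' ≠ 0 := by positivity
    rw [mul_div_assoc', eq_div_iff h0]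
    -- Subtract `dim F₁ - d' dim F₂ = Tr Ψ` from `dim F₁ + dim F₂ = n(n+1)/2`.
    have e1 : (Module.finrank ℝ (F₂ V) : ℝ) * (1 + d') =
        n * (n + 1) / 2 - (1 + (r - 1) * d') * n := by linarith
    rw [e1, hnr]
    ring
  refine ⟨Ψ, hsymm, fun y => congrArg Subtype.val (hΨT y),
    fun y => ⟨hP y, congrArg Subtype.val (hΨP y)⟩, ?_, hcompl, heig1, heig2, ?_, ?_, ?_, ?_, hdimF2⟩
  · intro f hf g hg
    have e1 := hsymm f g
    rw [Module.End.mem_eigenspace_iff.1 (hle1 hf), Module.End.mem_eigenspace_iff.1 (hle2 hg),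
      one_smul, Submodule.coe_smul, mul_smul_comm, map_smul, smul_eq_mul] at e1
    have e2 : (1 + d') *
        LinearMap.trace ℝ V ((f : Module.End ℝ V) * (g : Module.End ℝ V)) = 0 := by linarith
    exact (mul_eq_zero.1 e2).resolve_left (by positivity)
  -- The generator at `y = 1` is nonzero: it sends `1` to `(d' r + 1) • 1`.
  · have hmem : d' • (⟨tensor 1 1, tensor_self_mem 1⟩ : symOp V) + ⟨P 1, hP 1⟩ ∈
        Module.End.eigenspace Ψ 1 := by
      refine hle1 ?_
      rw [hF1]
      exact Submodule.subset_span ⟨1, rfl⟩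
    refine Module.End.hasEigenvalue_of_hasEigenvector ⟨hmem, fun h0 => ?_⟩
    have e1 : d' • tensor (1 : V) 1 + P 1 = 0 := congrArg Subtype.val h0
    have e2 := LinearMap.congr_fun e1 1
    rw [LinearMap.add_apply, LinearMap.smul_apply, tensor_apply htr, P_apply_self (mul_one 1), hB1,
      LinearMap.zero_apply] at e2
    have e3 : (d' * r + 1) • (1 : V) = 0 := by
      linear_combination (norm := module) e2
    have e4 : d' * r + 1 ≠ 0 := by positivity
    exact one_ne_zero ((smul_eq_zero.1 e3).resolve_left e4)
  -- For `r ≥ 2` every factor of the dimension formula is positive, so `F₂ ≠ 0`.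
  · intro hr2
    rw [Module.End.hasEigenvalue_iff, heig2]
    intro hbot
    rw [hbot, finrank_bot] at hdimF2
    have hr2' : (2 : ℝ) ≤ r := by exact_mod_cast hr2
    have p1 : 0 < (r : ℝ) * (r - 1) / 2 := by
      have : 0 < (r : ℝ) - 1 := by linarith
      positivity
    have p2 : 0 < 1 + d' * (2 * r - 3) + d' ^ 2 * (r - 1) * (r - 2) := by
      have q1 : 0 ≤ (2 : ℝ) * r - 3 := by linarith
      have q2 : 0 ≤ (r : ℝ) - 1 := by linarith
      have q3 : 0 ≤ (r : ℝ) - 2 := by linarith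
      positivity
    have p3 : 0 < (r : ℝ) * (r - 1) / 2 *
        ((1 + d' * (2 * r - 3) + d' ^ 2 * (r - 1) * (r - 2)) / (1 + d')) := by positivity
    rw [← hdimF2] at p3
    simp at p3
  · exact fun μ hμ => eigenvalue_of_isCompl hcompl hle1 hle2 hμ
  · linarith
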